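/- All vectors carry the max-norm $|\cdot|$. **Networks.** A DNN is a composition of layers followed by a linear output layer $v\mapsto Wv$; a layer is either of the form $v\mapsto Wv+b$ with the ReLU activation applied in some of the units and no activation in the others (skip connections), or it is at most bilinear, with units $\sum_{k,l}B_{ikl}v_kv_l+(Wv)_i$. The size $\#\mathcal N$ is the number of nonzero weights. The DNNs below have the inputs $(t,x,y)\in\mathbb R^{1+m+d_y}$ and outputs in $\mathbb R^m$. **Composition norm.** A representation $\mathbf g=(g^1,\dots,g^n)$ of a map $G$ on a set $E\subset\mathbb R^d$ consists of factors with $G=g^n\circ\cdots\circ g^1$ on $E$ and $g^n$ linear. Let $\mathfrak s(v)$ be the number of variables on which a scalar function $v$ depends. Put $\mathfrak N(\mathbf g)=\sum_j\sum_i\mathfrak s(g^j_i)$ and $\mathfrak s_\infty(\mathbf g)=\max_{j<n}\mathfrak s_\infty(g^j)$ ($0$ if $n=1$), where $\mathfrak s_\infty(g^j)$ is $0$ if $g^j$ is the identity, $1$ if $g^j$ is multilinear (each component is affine in each variable separately), and $\max_i\mathfrak s(g^j_i)$ otherwise. Let $\mathcal R(\mathbf g)$ be the maximum of $1$, of the norms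 $\|g^j\|_{\mathrm{Lip}_1}=\max\{\|g^j\|_\infty,|g^j|_{\mathrm{Lip}_1}\}$ and of the Lipschitz constants of the partial compositions $g^n\circ\cdots\circ g^j$, $1\le j\le n$, each taken on the image of $E$ under the preceding factors. Then $|||G|||_{N,s}$ is the infimum of $\mathcal R(\mathbf g)$ over the representations $\mathbf g$ of $G$ on $E$ with $\mathfrak s_\infty(\mathbf g)\le s$ and $\mathfrak N(\mathbf g)\le N$. **Theorem.** Let $m\ge1$. There is a constant $c_3>0$ depending only on $m$, and for every bounded $D\subset\mathbb R^m$ a constant $C>0$ depending only on $m$ and $D$, such that the following holds for all $d_y\ge1$, $T>0$, $A>0$, $\omega\in[0,\infty)^{d_y}$, $A^\circ$, $\Lambda$, with $|\omega|_1=\sum_j\omega_j$. Let $$a(t,x;y)=\sum_{j=1}^{d_y}y_j\,\omega_j\,a_j^\circ(t,x),\qquad y\in\mathcal Y=[-1,1]^{d_y},$$ where each $a_j^\circ$ is measurable in $t$ and, for $t\in[0,T]$ and $x,x'\in\mathbb R^m$, $$|a_j^\circ(t,x)|\le A^\circ,\qquad |a_j^\circ(t,x)-a_j^\circ(t,x')|\le\Lambda|x-x'|,\qquad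 \sum_{j}|\omega_ja_j^\circ(t,x)|\le A.$$ Let $z(t,x,y)$ be the characteristic field, that is, $t\mapsto z(t,x,y)$ is continuous on $[0,T]$ and $z(t,x,y)=x+\int_0^ta(s,z(s,x,y);y)\,ds$. Put $$L=A+\Lambda|\omega|_1,\qquad \hat L=A+T^{-1}+c_3(1+A^\circ)\Lambda|\omega|_1 .$$ 1. For every $\varepsilon>0$ with $\varepsilon\le\min\{\tfrac12,AT\}\,e^{LT}$ there is a DNN $\mathcal N_\varepsilon$ with $$\|z-\mathcal N_\varepsilon\|_{L_\infty([0,T]\times D\times\mathcal Y)}\le\varepsilon,\qquad \#\mathcal N_\varepsilon\le C\,d_y\,m^2\,A\,T\Big(\frac{e^{LT}}{\varepsilon}\Big)^{m+1}\Big|\log_2\frac{e^{LT}}{\varepsilon}\Big|^2 .$$ 2. For every integer $N\ge\max\{2d_y,m\}$ there is a DNN $\mathcal N_N$ with $\#\mathcal N_N\le N$ and $$\|z-\mathcal N_N\|_{L_\infty([0,T]\times D\times\mathcal Y)}\le C\,e^{LT}\,\tilde\gamma(N)^{-1},\qquad \tilde\gamma(r)=(ATm^2)^{-\frac1{m+1}}\Big(\frac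 r{d_y}\Big)^{\frac1{m+1}}\Big|\log_2\frac r{d_y}\Big|^{-\frac2{m+1}} .$$ 3. The networks $\mathcal N=\mathcal N_\varepsilon$ in 1 (with $N:=\#\mathcal N_\varepsilon$) and $\mathcal N=\mathcal N_N$ in 2 can be chosen such that moreover $$|\mathcal N(t,x,y)-\mathcal N(t',x,y)|\le C(A+T^{-1})|t-t'|,\qquad t,t'\in[0,T],\ (x,y)\in D\times\mathcal Y,$$ and, on $E=D\times\mathcal Y$, $|||\mathcal N(t,\cdot,\cdot)|||_{N,m}\le C\,e^{\hat LT}$ for all $t\in[0,T]$. -/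

import Mathlib

noncomputable section

namespace TransportDNN

/-! ### Norms on subsets of `ℝ^d` (all vectors carry the max-norm) -/

/-- The supremum norm of `g` on `D`. -/
def supNormOn {d e : ℕ} (D : Set (Fin d → ℝ)) (g : (Fin d → ℝ) → Fin e → ℝ) : ENNReal :=
  ⨆ x ∈ D, ‖g x‖ₑ

/-- The Lipschitz constant of `g` on `D` (pairs `x = x'` contribute `0 / 0 = 0`). -/
def lipSemiOn {d e : ℕ} (D : Set (Fin d → ℝ)) (g : (Fin d → ℝ) → Fin e → ℝ) : ENNReal :=
  ⨆ x ∈ D, ⨆ x' ∈ D, edist (g x) (g x') / edist x x'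

/-- The full Lipschitz norm of `g` on `D`. -/
def lipNormOn {d e : ℕ} (D : Set (Fin d → ℝ)) (g : (Fin d → ℝ) → Fin e → ℝ) : ENNReal :=
  max (supNormOn D g) (lipSemiOn D g)

/-! ### Compositional representations -/

/-- The number of variables on which a scalar function actually depends. -/
def numVars {d : ℕ} (v : (Fin d → ℝ) → ℝ) : ℕ :=
  Set.ncard {k : Fin d | ∃ (x : Fin d → ℝ) (c : ℝ), v (Function.update x k c) ≠ v x}

/-- `g` is the identity map (which forces `e = d`). -/
def IsIdentity {d e : ℕ} (g : (Fin d → ℝ) → Fin e → ℝ) : Prop :=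
  ∃ h : e = d, ∀ x i, g x i = x (Fin.cast h i)

/-- Every component of `g` is a multilinear polynomial, that is, affine in each variable
separately. This covers linear maps and sums of products of distinct variables. -/
def IsMultilin {d e : ℕ} (g : (Fin d → ℝ) → Fin e → ℝ) : Prop :=
  ∀ (i : Fin e) (x : Fin d → ℝ) (k : Fin d), ∃ p q : ℝ, ∀ c : ℝ,
    g (Function.update x k c) i = p + c * q

open Classical in
/-- The dimension sparsity of one factor: `0` for the identity, `1` for a multilinear factor, and
otherwise the largest number of variables on which a component depends. -/
def factorSparsity {d e : ℕ} (g : (Fin d → ℝ) → Fin e → ℝ) : ℕ :=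
  if IsIdentity g then 0
  else if IsMultilin g then 1
  else Finset.univ.sup fun i => numVars fun x => g x i

/-- A compositional representation `gⁿ ∘ ⋯ ∘ g¹` of a map `ℝ^d → ℝ^e`, whose last factor `gⁿ` is
linear. `comp g r` has the first factor `g`, followed by the factors of `r`. -/
inductive Rep : ℕ → ℕ → Type
  | last {d e : ℕ} (M : Matrix (Fin e) (Fin d) ℝ) : Rep d e
  | comp {d k e : ℕ} (g : (Fin d → ℝ) → Fin k → ℝ) (r : Rep k e) : Rep d e

namespace Rep

/-- The represented map. -/
def eval : {d e : ℕ} → Rep d e → (Fin d → ℝ) → Fin e → ℝ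
  | _, _, last M => M.mulVec
  | _, _, comp g r => fun x => r.eval (g x)

/-- The compositional complexity: the sum, over all components of all factors, of the number of
variables on which the component depends. -/
def complexity : {d e : ℕ} → Rep d e → ℕ
  | _, _, last M => ∑ i, numVars fun x => M.mulVec x i
  | _, _, comp g r => (∑ i, numVars fun x => g x i) + r.complexity

/-- The dimension sparsity of a representation: the maximum over all factors but the last. -/
def sparsity : {d e : ℕ} → Rep d e → ℕ
  | _, _, last _ => 0
  | _, _, comp g r => max (factorSparsity g) r.sparsity

/-- The regularizer of a representation of a map with domain `D`: the maximum of the Lipschitz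
norms of all factors and of the Lipschitz constants of all partial compositions
`gⁿ ∘ ⋯ ∘ gˡ`, `1 ≤ l ≤ n`, and of the constant `1` of the empty one. Each factor is considered on
the image of `D` under the preceding factors. -/
def reg : {d e : ℕ} → Rep d e → Set (Fin d → ℝ) → ENNReal
  | _, _, last M, D => max 1 (lipNormOn D M.mulVec)
  | _, _, comp g r, D =>
      max (max (lipNormOn D g) (lipSemiOn D fun x => r.eval (g x))) (r.reg (g '' D))

end Rep

/-- The composition norm of `G : D → ℝ^e` for complexity `N` and dimension sparsity `s`; it is `⊤`
if `G` has no such representation. -/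
def tripNorm {d e : ℕ} (N s : ℕ) (D : Set (Fin d → ℝ)) (G : (Fin d → ℝ) → Fin e → ℝ) : ENNReal :=
  ⨅ (r : Rep d e) (_ : Set.EqOn r.eval G D) (_ : r.sparsity ≤ s) (_ : r.complexity ≤ N), r.reg D

/-! ### Deep neural networks -/

/-- Deep neural networks with ReLU layers, skip connections, and layers that are at most bilinear.
* `output W`: the linear output layer `x ↦ W x`.
* `affine W b σ net`: first the layer `x ↦ W x + b`, with the ReLU activation applied in the units
  `i` with `σ i = true` and no activation in the others (skip connections), then `net`.
* `bilinear B W net`: first the layer with units `∑ k l, B i k l * x k * x l + (W x) i`,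
  then `net`. -/
inductive Net : ℕ → ℕ → Type
  | output {d e : ℕ} (W : Matrix (Fin e) (Fin d) ℝ) : Net d e
  | affine {d k e : ℕ} (W : Matrix (Fin k) (Fin d) ℝ) (b : Fin k → ℝ) (σ : Fin k → Bool)
      (net : Net k e) : Net d e
  | bilinear {d k e : ℕ} (B : Fin k → Fin d → Fin d → ℝ) (W : Matrix (Fin k) (Fin d) ℝ)
      (net : Net k e) : Net d e

namespace Net

/-- The function realized by a network. -/
def eval : {d e : ℕ} → Net d e → (Fin d → ℝ) → Fin e → ℝ
  | _, _, output W => W.mulVec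
  | _, _, affine W b σ net => fun x => net.eval fun i =>
      if σ i = true then max 0 (W.mulVec x i + b i) else W.mulVec x i + b i
  | _, _, bilinear B W net => fun x => net.eval fun i =>
      (∑ k, ∑ l, B i k l * x k * x l) + W.mulVec x i

/-- The size of a network: the number of its nonzero weights, in all layers. -/
def size : {d e : ℕ} → Net d e → ℕ
  | _, _, output W => Set.ncard {p : Fin _ × Fin _ | W p.1 p.2 ≠ 0}
  | _, _, affine W b _ net =>
      Set.ncard {p : Fin _ × Fin _ | W p.1 p.2 ≠ 0} + Set.ncard {i | b i ≠ 0} + net.size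
  | _, _, bilinear B W net =>
      Set.ncard {p : Fin _ × Fin _ × Fin _ | B p.1 p.2.1 p.2.2 ≠ 0} +
        Set.ncard {p : Fin _ × Fin _ | W p.1 p.2 ≠ 0} + net.size

/-- A network with inputs `(t, x, y)`, the time `t` being the input number `0`. -/
def evalTXY {m dy : ℕ} (net : Net (m + dy + 1) m) (t : ℝ) (x : Fin m → ℝ) (y : Fin dy → ℝ) :
    Fin m → ℝ :=
  net.eval (Fin.cons t (Fin.append x y))

end Net

/-! ### Affine parametric convection fields and their characteristics -/

/-- The parameter domain `[-1,1]^dy`. -/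
def paramBox (dy : ℕ) : Set (Fin dy → ℝ) := Set.Icc (fun _ => -1) (fun _ => 1)

/-- `D × [-1,1]^dy` as a subset of `ℝ^(m + dy)`. -/
def spaceParam {m : ℕ} (D : Set (Fin m → ℝ)) (dy : ℕ) : Set (Fin (m + dy) → ℝ) :=
  Set.image2 Fin.append D (paramBox dy)

/-- The convection field `a(t,x;y) = ∑ j, y_j ω_j a_j(t,x)`. -/
def convField {m dy : ℕ} (ω : Fin dy → ℝ) (a : Fin dy → ℝ → (Fin m → ℝ) → Fin m → ℝ)
    (t : ℝ) (x : Fin m → ℝ) (y : Fin dy → ℝ) : Fin m → ℝ :=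
  ∑ j, (y j * ω j) • a j t x

/-- `z` is the field of characteristics on `[0,T]`, that is, for each `x` and `y`, the continuous
solution of `z' = a(t,z;y)`, `z(0) = x`, written as an integral equation. -/
def IsCharField {m dy : ℕ} (T : ℝ) (ω : Fin dy → ℝ)
    (a : Fin dy → ℝ → (Fin m → ℝ) → Fin m → ℝ)
    (z : ℝ → (Fin m → ℝ) → (Fin dy → ℝ) → Fin m → ℝ) : Prop :=
  ∀ x, ∀ y ∈ paramBox dy, ContinuousOn (fun t => z t x y) (Set.Icc 0 T) ∧
    ∀ t ∈ Set.Icc 0 T, z t x y = x + ∫ s in (0 : ℝ)..t, convField ω a s (z s x y) y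

/-! ### The quantities in the estimates -/

/-- `‖z - 𝒩‖_∞ ≤ ε` on `[0,T] × D × [-1,1]^dy`. -/
def ApproxWithin {m dy : ℕ} (T : ℝ) (D : Set (Fin m → ℝ))
    (z : ℝ → (Fin m → ℝ) → (Fin dy → ℝ) → Fin m → ℝ) (net : Net (m + dy + 1) m) (ε : ℝ) : Prop :=
  ∀ t ∈ Set.Icc 0 T, ∀ x ∈ D, ∀ y ∈ paramBox dy, ‖z t x y - net.evalTXY t x y‖ ≤ ε

/-- `|𝒩(t,x,y) - 𝒩(t',x,y)| ≤ K |t - t'|` on `[0,T]`, uniformly in `(x,y) ∈ D × [-1,1]^dy`. -/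
def TimeLipschitz {m dy : ℕ} (T : ℝ) (D : Set (Fin m → ℝ)) (net : Net (m + dy + 1) m)
    (K : ℝ) : Prop :=
  ∀ t ∈ Set.Icc 0 T, ∀ t' ∈ Set.Icc 0 T, ∀ x ∈ D, ∀ y ∈ paramBox dy,
    ‖net.evalTXY t x y - net.evalTXY t' x y‖ ≤ K * |t - t'|

/-- The composition norm of `(x,y) ↦ 𝒩(t,x,y)` on `D × [-1,1]^dy`, for complexity `N` and dimension
sparsity `m`, is at most `K` for all `t ∈ [0,T]`. -/
def CompStable {m dy : ℕ} (T : ℝ) (D : Set (Fin m → ℝ)) (net : Net (m + dy + 1) m)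
    (N : ℕ) (K : ℝ) : Prop :=
  ∀ t ∈ Set.Icc 0 T,
    tripNorm N m (spaceParam D dy) (fun v => net.eval (Fin.cons t v)) ≤ ENNReal.ofReal K

/-- The growth function
`(A T m²)^(-1/(m+1)) (r/dy)^(1/(m+1)) |log₂ (r/dy)|^(-2/(m+1))`. -/
def growth (m dy : ℕ) (A T r : ℝ) : ℝ :=
  (A * T * (m : ℝ) ^ 2) ^ (-(1 / ((m : ℝ) + 1))) * (r / dy) ^ (1 / ((m : ℝ) + 1)) *
    |Real.logb 2 (r / dy)| ^ (-(2 / ((m : ℝ) + 1)))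

end TransportDNN

end

/-!
The characteristics are approximated by an explicit Euler method with `n` steps of length
`h = T / n`, in which the velocity components `a_j(t, ·)` are replaced by their averages over the
time steps, interpolated on a uniform grid with `K` cells per direction.

*Error.* If `D` lies in the ball of radius `R`, then the discrete trajectories that start in `D` stay
in the ball of radius `ρ = R + A T`, so the grid is chosen on `[-ρ, ρ]^m`. The averages make the
time discretization first-order accurate although `a_j` is only measurable in time, and a discrete
Gronwall argument (`IsVelocityFamily.norm_curve_sub_euler_le`) bounds the error by a multiple of
`exp (Λ |ω|₁ T) (A T / n + (R + A T) / K)`. The factor `R + A T` is absorbed by `exp (A T)`.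

*Network.* Hat functions are built from ReLU units, their tensor products from bilinear layers, and
the Euler update is linear in the products of `y_j` with the nodal basis. So the discrete flow is
realized exactly (`exists_net_euler`), with about `d_y n K^m` weights. Time enters through the clocks
`ramp (t / h - k)`, which carry out the `k`-th step linearly during the `k`-th time interval. A step
is started only when the previous ones are complete, hence the Lipschitz constant in time is at most
`A` (`VelocityBounds.norm_euler_ramp_sub_le`).

*Composition norm.* The hat functions have large Lipschitz constants, so the layers of the network
are useless as factors of a representation. The representation `flowRep` uses for each step one
factor which evaluates all interpolated velocity components, each depending on the `m` variables `x`
only, followed by a multilinear factor. Interpolation preserves Lipschitz constants up to the factor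
`4 m` (`norm_gridInterp_sub_gridInterp_le`), which is the source of the constant `c₃ = 4 m`. The
number of parameters does not enter the Lipschitz constants, because the velocity components are
scaled by `h |ω|₁` and their sum is weighted by `ω_j / |ω|₁` (`reg_flowRep_le`). Unused biases make
the size of the network at least the complexity of the representation.

*Parameters.* For accuracy `δ = ε exp (-L T)` one takes `n ~ A T / δ` and `K ~ 1 / δ`. For prescribed
size `N` the same choice is made with `δ ~ (A T d_y / N)^(1 / (m + 1))`, unless `N` is so small that
this `δ` exceeds a constant or `A T`; then the network `(t, x, y) ↦ x` is accurate enough. The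
logarithmic factors are not needed, since products are exact.
-/

noncomputable section

namespace TransportDNN

open Finset

/-! ### Ramps and hat functions -/

/-- The ramp `s ↦ min (max s 0) 1`, written with two ReLU units. -/
def ramp (s : ℝ) : ℝ := max 0 s - max 0 (s - 1)

/-- The hat function `s ↦ max 0 (1 - |s|)`, written with ReLU units. -/
def hat (s : ℝ) : ℝ := max 0 (1 - max 0 s - max 0 (-s))

theorem ramp_of_nonpos {s : ℝ} (h : s ≤ 0) : ramp s = 0 := by
  unfold ramp; rw [max_eq_left h, max_eq_left (by linarith)]; ring

theorem ramp_of_one_le {s : ℝ} (h : 1 ≤ s) : ramp s = 1 := by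
  unfold ramp; rw [max_eq_right (by linarith), max_eq_right (by linarith)]; ring

theorem ramp_of_mem {s : ℝ} (h0 : 0 ≤ s) (h1 : s ≤ 1) : ramp s = s := by
  unfold ramp; rw [max_eq_right h0, max_eq_left (by linarith)]; ring

theorem ramp_mono : Monotone ramp := by
  intro s s' h
  rcases le_total s 0 with h0 | h0 <;> rcases le_total s 1 with h1 | h1 <;>
  rcases le_total s' 0 with h0' | h0' <;> rcases le_total s' 1 with h1' | h1' <;>
  first
  | linarith
  | (simp only [ramp_of_nonpos, ramp_of_one_le, ramp_of_mem, *]; try linarith)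

theorem ramp_nonneg (s : ℝ) : 0 ≤ ramp s := by
  rw [← ramp_of_nonpos (min_le_right s 0)]; exact ramp_mono (min_le_left _ _)

theorem ramp_le_one (s : ℝ) : ramp s ≤ 1 := by
  rw [← ramp_of_one_le (le_max_right s 1)]; exact ramp_mono (le_max_left _ _)

theorem sum_ramp (s : ℝ) (n : ℕ) : ∑ k ∈ range n, ramp (s - k) = min (max s 0) n := by
  induction n with
  | zero => simp
  | succ n ih =>
    rw [sum_range_succ, ih]
    push_cast
    rcases le_total s n with h | h
    · rw [ramp_of_nonpos (by linarith), add_zero, min_eq_left, min_eq_left]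
      · exact max_le (by linarith) (by positivity)
      · exact max_le h (by positivity)
    · have hs : 0 ≤ s := le_trans (by positivity) h
      rw [max_eq_left hs, min_eq_right h]
      rcases le_total s (n + 1) with h' | h'
      · rw [ramp_of_mem (by linarith) (by linarith), min_eq_left h']; ring
      · rw [ramp_of_one_le (by linarith), min_eq_right h']

theorem sum_abs_ramp_sub (s s' : ℝ) (n : ℕ) :
    ∑ k ∈ range n, |ramp (s - k) - ramp (s' - k)| ≤ |s - s'| := by
  wlog h : s' ≤ s generalizing s s'
  · simpa only [abs_sub_comm] using this s' s (le_of_not_ge h)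
  have : ∀ k ∈ range n, |ramp (s - k) - ramp (s' - k)| = ramp (s - k) - ramp (s' - k) :=
    fun k _ => abs_of_nonneg (sub_nonneg.2 (ramp_mono (by linarith)))
  rw [sum_congr rfl this, sum_sub_distrib, sum_ramp, sum_ramp]
  refine (le_abs_self _).trans ((abs_min_sub_min_le_max _ _ _ _).trans ?_)
  simp only [sub_self, abs_zero, abs_nonneg, sup_of_le_left]
  simpa using abs_max_sub_max_le_max s 0 s' 0

theorem hat_nonneg (s : ℝ) : 0 ≤ hat s := le_max_left _ _

theorem hat_eq_ramp_sub (s : ℝ) : hat s = ramp (s + 1) - ramp s := by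
  unfold hat
  rcases le_total s 0 with h | h
  · rw [ramp_of_nonpos h, max_eq_left h, max_eq_right (by linarith : 0 ≤ -s)]
    rcases le_total s (-1) with h' | h'
    · rw [ramp_of_nonpos (by linarith), max_eq_left (by linarith)]; ring
    · rw [ramp_of_mem (by linarith) (by linarith), max_eq_right (by linarith)]; ring
  · rw [ramp_of_one_le (by linarith), max_eq_right h, max_eq_left (by linarith : -s ≤ 0)]
    rcases le_total s 1 with h' | h'
    · rw [ramp_of_mem h h', max_eq_right (by linarith)]; ring
    · rw [ramp_of_one_le h', max_eq_left (by linarith)]; ring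

theorem abs_lt_one_of_hat_ne_zero {s : ℝ} (h : hat s ≠ 0) : |s| < 1 := by
  by_contra! h1
  apply h
  rw [hat_eq_ramp_sub]
  rcases le_abs.1 h1 with h2 | h2
  · rw [ramp_of_one_le h2, ramp_of_one_le (by linarith), sub_self]
  · rw [ramp_of_nonpos (by linarith), ramp_of_nonpos (by linarith), sub_self]

theorem sum_hat {s : ℝ} {K : ℕ} (h0 : 0 ≤ s) (hK : s ≤ K) :
    ∑ k : Fin (K + 1), hat (s - k) = 1 := by
  rw [Fin.sum_univ_eq_sum_range (fun k => hat (s - k)) (K + 1)]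
  have : ∀ k ∈ range (K + 1), hat (s - k) = ramp (s + 1 - k) - ramp (s - k) := by
    intro k _; rw [hat_eq_ramp_sub]; congr 2; ring
  rw [sum_congr rfl this, sum_sub_distrib, sum_ramp, sum_ramp]
  push_cast
  rw [max_eq_left h0, max_eq_left (by linarith), min_eq_left (by linarith),
    min_eq_left (by linarith)]
  ring

theorem sum_abs_hat_sub (s s' : ℝ) (K : ℕ) :
    ∑ k : Fin (K + 1), |hat (s - k) - hat (s' - k)| ≤ 2 * |s - s'| := by
  rw [Fin.sum_univ_eq_sum_range (fun k => |hat (s - k) - hat (s' - k)|) (K + 1)]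
  have h : ∀ k ∈ range (K + 1), |hat (s - k) - hat (s' - k)| ≤
      |ramp (s + 1 - k) - ramp (s' + 1 - k)| + |ramp (s - k) - ramp (s' - k)| := by
    intro k _
    rw [hat_eq_ramp_sub, hat_eq_ramp_sub, sub_add_eq_add_sub, sub_add_eq_add_sub]
    refine le_trans (le_of_eq ?_) (abs_sub _ _)
    congr 1; ring
  refine (sum_le_sum h).trans ?_
  rw [sum_add_distrib]
  have h1 := sum_abs_ramp_sub (s + 1) (s' + 1) (K + 1)
  have h2 := sum_abs_ramp_sub s s' (K + 1)
  rw [add_sub_add_right_eq_sub] at h1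
  linarith

/-- The total variation distance of two product measures is at most the sum of the distances of
their factors. -/
theorem sum_abs_prod_sub_prod_le {κ : Type*} [Fintype κ] :
    ∀ {m : ℕ} (a b : Fin m → κ → ℝ), (∀ p k, 0 ≤ a p k) → (∀ p k, 0 ≤ b p k) →
      (∀ p, ∑ k, a p k = 1) → (∀ p, ∑ k, b p k = 1) →
      ∑ ν : Fin m → κ, |∏ p, a p (ν p) - ∏ p, b p (ν p)| ≤ ∑ p, ∑ k, |a p k - b p k| := by
  classical
  intro m
  induction m with
  | zero => intro a b _ _ _ _; simp
  | succ m ih =>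
    intro a b ha hb ha1 hb1
    have ih' := ih (fun p => a p.succ) (fun p => b p.succ) (fun p => ha _) (fun p => hb _)
      (fun p => ha1 _) (fun p => hb1 _)
    rw [← (Fin.consEquiv fun _ => κ).sum_comp, Fintype.sum_prod_type, Fin.sum_univ_succ]
    have key : ∀ (k : κ) (ν : Fin m → κ),
        |∏ p, a p (Fin.consEquiv (fun _ => κ) (k, ν) p) -
          ∏ p, b p (Fin.consEquiv (fun _ => κ) (k, ν) p)| ≤
        |a 0 k - b 0 k| * (∏ p, a (Fin.succ p) (ν p)) +
          b 0 k * |∏ p, a (Fin.succ p) (ν p) - ∏ p, b (Fin.succ p) (ν p)| := by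
      intro k ν
      rw [Fin.prod_univ_succ, Fin.prod_univ_succ]
      simp only [Fin.consEquiv_apply, Fin.cons_zero, Fin.cons_succ]
      have hp : 0 ≤ ∏ p, a (Fin.succ p) (ν p) := prod_nonneg fun p _ => ha _ _
      calc _ = |(a 0 k - b 0 k) * (∏ p, a (Fin.succ p) (ν p)) +
            b 0 k * (∏ p, a (Fin.succ p) (ν p) - ∏ p, b (Fin.succ p) (ν p))| := by congr 1; ring
        _ ≤ _ := (abs_add_le _ _).trans (by
            rw [abs_mul, abs_mul, abs_of_nonneg hp, abs_of_nonneg (hb 0 k)])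
    have hprod : ∑ ν : Fin m → κ, ∏ p, a (Fin.succ p) (ν p) = 1 := by
      rw [← Fintype.prod_sum fun p : Fin m => a p.succ]; simp [ha1]
    refine (sum_le_sum fun k _ => sum_le_sum fun ν _ => key k ν).trans ?_
    simp only [sum_add_distrib, ← mul_sum, ← sum_mul, hprod, mul_one, hb1, one_mul]
    simpa using ih'

/-! ### Interpolation on a tensor grid -/

/-- The number of grid cells per unit of length, for a grid with `K` cells on `[-ρ, ρ]`. -/
def gridDensity (ρ : ℝ) (K : ℕ) : ℝ := K / (2 * ρ)

/-- The multilinear nodal basis function of the node `ν` of the uniform grid on `[-ρ, ρ]^m` with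
`K` cells per direction. -/
def gridBasis {m : ℕ} (ρ : ℝ) (K : ℕ) (ν : Fin m → Fin (K + 1)) (x : Fin m → ℝ) : ℝ :=
  ∏ p, hat (gridDensity ρ K * x p + gridDensity ρ K * ρ - (ν p : ℕ))

/-- The node `ν` of the uniform grid on `[-ρ, ρ]^m` with `K` cells per direction. -/
def gridNode {m : ℕ} (ρ : ℝ) (K : ℕ) (ν : Fin m → Fin (K + 1)) (p : Fin m) : ℝ :=
  (gridDensity ρ K)⁻¹ * (ν p : ℕ) - ρ

/-- The continuous, piecewise multilinear interpolant of `f` on the uniform grid. -/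
def gridInterp {m e : ℕ} (ρ : ℝ) (K : ℕ) (f : (Fin m → ℝ) → Fin e → ℝ) (x : Fin m → ℝ) :
    Fin e → ℝ :=
  ∑ ν, gridBasis ρ K ν x • f (gridNode ρ K ν)

section Interp

variable {m e : ℕ} {ρ : ℝ} {K : ℕ}

theorem gridDensity_pos (hρ : 0 < ρ) (hK : 1 ≤ K) : 0 < gridDensity ρ K := by
  unfold gridDensity
  have : (0 : ℝ) < K := by exact_mod_cast hK
  positivity

theorem gridBasis_nonneg (ν : Fin m → Fin (K + 1)) (x : Fin m → ℝ) : 0 ≤ gridBasis ρ K ν x :=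
  prod_nonneg fun _ _ => hat_nonneg _

theorem gridCoord_mem (hρ : 0 < ρ) (hK : 1 ≤ K) {x : Fin m → ℝ} (hx : ‖x‖ ≤ ρ) (p : Fin m) :
    0 ≤ gridDensity ρ K * x p + gridDensity ρ K * ρ ∧
      gridDensity ρ K * x p + gridDensity ρ K * ρ ≤ K := by
  have hd := gridDensity_pos hρ hK
  have h := abs_le.1 ((norm_le_pi_norm x p).trans hx)
  constructor
  · rw [← mul_add]; exact mul_nonneg hd.le (by linarith)
  · calc gridDensity ρ K * x p + gridDensity ρ K * ρ ≤ gridDensity ρ K * (2 * ρ) := by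
          rw [← mul_add]; exact mul_le_mul_of_nonneg_left (by linarith) hd.le
      _ = K := by unfold gridDensity; field_simp

theorem sum_gridBasis (hρ : 0 < ρ) (hK : 1 ≤ K) {x : Fin m → ℝ} (hx : ‖x‖ ≤ ρ) :
    ∑ ν, gridBasis ρ K ν x = 1 := by
  unfold gridBasis
  rw [← Fintype.prod_sum fun (p : Fin m) (k : Fin (K + 1)) =>
    hat (gridDensity ρ K * x p + gridDensity ρ K * ρ - (k : ℕ))]
  exact prod_eq_one fun p _ => sum_hat (gridCoord_mem hρ hK hx p).1 (gridCoord_mem hρ hK hx p).2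

theorem norm_gridNode_sub_le (hρ : 0 < ρ) (hK : 1 ≤ K) {x : Fin m → ℝ}
    {ν : Fin m → Fin (K + 1)} (h : gridBasis ρ K ν x ≠ 0) :
    ‖gridNode ρ K ν - x‖ ≤ (gridDensity ρ K)⁻¹ := by
  have hd := gridDensity_pos hρ hK
  refine (pi_norm_le_iff_of_nonneg (inv_nonneg.2 hd.le)).2 fun p => ?_
  have h1 := abs_lt_one_of_hat_ne_zero (prod_ne_zero_iff.1 h p (mem_univ p))
  have : gridNode ρ K ν p - x p = (gridDensity ρ K)⁻¹ *
      (-(gridDensity ρ K * x p + gridDensity ρ K * ρ - (ν p : ℕ))) := by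
    unfold gridNode; field_simp; ring
  rw [Pi.sub_apply, this, norm_mul, norm_neg, Real.norm_eq_abs, abs_of_pos (inv_pos.2 hd)]
  exact mul_le_of_le_one_right (inv_nonneg.2 hd.le) h1.le

theorem gridInterp_sub (hρ : 0 < ρ) (hK : 1 ≤ K) (f : (Fin m → ℝ) → Fin e → ℝ)
    {x : Fin m → ℝ} (hx : ‖x‖ ≤ ρ) (v : Fin e → ℝ) :
    gridInterp ρ K f x - v = ∑ ν, gridBasis ρ K ν x • (f (gridNode ρ K ν) - v) := by
  simp only [smul_sub, sum_sub_distrib, ← sum_smul, sum_gridBasis hρ hK hx, one_smul]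
  rfl

theorem norm_gridInterp_sub_le (hρ : 0 < ρ) (hK : 1 ≤ K) {f : (Fin m → ℝ) → Fin e → ℝ} {Λ : ℝ}
    (hΛ : 0 ≤ Λ) (hf : ∀ x x', ‖f x - f x'‖ ≤ Λ * ‖x - x'‖) {x : Fin m → ℝ} (hx : ‖x‖ ≤ ρ) :
    ‖gridInterp ρ K f x - f x‖ ≤ Λ * (gridDensity ρ K)⁻¹ := by
  rw [gridInterp_sub hρ hK f hx]
  calc _ ≤ ∑ ν, gridBasis ρ K ν x * (Λ * (gridDensity ρ K)⁻¹) := by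
        refine norm_sum_le_of_le _ fun ν _ => ?_
        rw [norm_smul, Real.norm_eq_abs, abs_of_nonneg (gridBasis_nonneg ν x)]
        by_cases h : gridBasis ρ K ν x = 0
        · simp [h]
        · exact mul_le_mul_of_nonneg_left ((hf _ _).trans (mul_le_mul_of_nonneg_left
            (norm_gridNode_sub_le hρ hK h) hΛ)) (gridBasis_nonneg ν x)
    _ = _ := by rw [← sum_mul, sum_gridBasis hρ hK hx, one_mul]

theorem sum_abs_gridBasis_sub_le (hρ : 0 < ρ) (hK : 1 ≤ K) {x x' : Fin m → ℝ} (hx : ‖x‖ ≤ ρ)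
    (hx' : ‖x'‖ ≤ ρ) :
    ∑ ν, |gridBasis ρ K ν x - gridBasis ρ K ν x'| ≤ 2 * m * gridDensity ρ K * ‖x - x'‖ := by
  have hd := gridDensity_pos hρ hK
  refine (sum_abs_prod_sub_prod_le
    (fun p (k : Fin (K + 1)) => hat (gridDensity ρ K * x p + gridDensity ρ K * ρ - (k : ℕ)))
    (fun p (k : Fin (K + 1)) => hat (gridDensity ρ K * x' p + gridDensity ρ K * ρ - (k : ℕ)))
    (fun _ _ => hat_nonneg _) (fun _ _ => hat_nonneg _)
    (fun p => sum_hat (gridCoord_mem hρ hK hx p).1 (gridCoord_mem hρ hK hx p).2)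
    (fun p => sum_hat (gridCoord_mem hρ hK hx' p).1 (gridCoord_mem hρ hK hx' p).2)).trans ?_
  calc _ ≤ ∑ _p : Fin m, 2 * (gridDensity ρ K * ‖x - x'‖) := by
        refine sum_le_sum fun p _ => (sum_abs_hat_sub _ _ K).trans ?_
        rw [add_sub_add_right_eq_sub, ← mul_sub, abs_mul, abs_of_pos hd]
        gcongr
        exact norm_le_pi_norm (x - x') p
    _ = _ := by simp; ring

/-- Interpolation preserves Lipschitz continuity, up to a factor depending on the dimension. At
distances below the mesh width this follows from the variation of the nodal basis, at larger ones
from the interpolation error. -/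
theorem norm_gridInterp_sub_gridInterp_le (hm : 1 ≤ m) (hρ : 0 < ρ) (hK : 1 ≤ K)
    {f : (Fin m → ℝ) → Fin e → ℝ} {Λ : ℝ}
    (hΛ : 0 ≤ Λ) (hf : ∀ x x', ‖f x - f x'‖ ≤ Λ * ‖x - x'‖) {x x' : Fin m → ℝ}
    (hx : ‖x‖ ≤ ρ) (hx' : ‖x'‖ ≤ ρ) :
    ‖gridInterp ρ K f x - gridInterp ρ K f x'‖ ≤ 4 * m * Λ * ‖x - x'‖ := by
  have hd := gridDensity_pos hρ hK
  have hm' : (1 : ℝ) ≤ m := by exact_mod_cast hm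
  set η := (gridDensity ρ K)⁻¹ with hη
  have hηpos : 0 < η := inv_pos.2 hd
  rcases le_total η ‖x - x'‖ with h | h
  · have h1 := norm_gridInterp_sub_le hρ hK hΛ hf hx
    have h2 := norm_gridInterp_sub_le hρ hK hΛ hf hx'
    have h3 := hf x x'
    rw [← hη] at h1 h2
    have h4 : Λ * η ≤ Λ * ‖x - x'‖ := mul_le_mul_of_nonneg_left h hΛ
    calc _ = ‖(gridInterp ρ K f x - f x) + (f x - f x') - (gridInterp ρ K f x' - f x')‖ := by
          congr 1; abel
      _ ≤ ‖gridInterp ρ K f x - f x‖ + ‖f x - f x'‖ + ‖gridInterp ρ K f x' - f x'‖ :=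
          (norm_sub_le _ _).trans (add_le_add (norm_add_le _ _) le_rfl)
      _ ≤ 3 * (Λ * ‖x - x'‖) := by linarith
      _ ≤ 4 * m * (Λ * ‖x - x'‖) := by
          apply mul_le_mul_of_nonneg_right (by linarith); positivity
      _ = _ := by ring
  · have : gridInterp ρ K f x - gridInterp ρ K f x' =
        ∑ ν, (gridBasis ρ K ν x - gridBasis ρ K ν x') • (f (gridNode ρ K ν) - f x) := by
      rw [← sub_sub_sub_cancel_right _ _ (f x), gridInterp_sub hρ hK f hx,
        gridInterp_sub hρ hK f hx', ← sum_sub_distrib]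
      simp only [sub_smul]
    rw [this]
    calc _ ≤ ∑ ν, |gridBasis ρ K ν x - gridBasis ρ K ν x'| * (Λ * (2 * η)) := by
          refine norm_sum_le_of_le _ fun ν _ => ?_
          rw [norm_smul, Real.norm_eq_abs]
          by_cases h1 : gridBasis ρ K ν x = 0
          · by_cases h2 : gridBasis ρ K ν x' = 0
            · simp [h1, h2]
            · refine mul_le_mul_of_nonneg_left ((hf _ _).trans
                (mul_le_mul_of_nonneg_left ?_ hΛ)) (abs_nonneg _)
              have h3 := norm_gridNode_sub_le hρ hK h2
              have h4 := norm_sub_le_norm_sub_add_norm_sub (gridNode ρ K ν) x' x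
              rw [norm_sub_rev x' x] at h4
              rw [← hη] at h3
              linarith
          · refine mul_le_mul_of_nonneg_left ((hf _ _).trans
                (mul_le_mul_of_nonneg_left ?_ hΛ)) (abs_nonneg _)
            have h3 := norm_gridNode_sub_le hρ hK h1
            rw [← hη] at h3
            linarith
      _ ≤ (2 * m * gridDensity ρ K * ‖x - x'‖) * (Λ * (2 * η)) := by
          rw [← sum_mul]
          exact mul_le_mul_of_nonneg_right (sum_abs_gridBasis_sub_le hρ hK hx hx') (by positivity)
      _ = _ := by rw [hη]; field_simp; ring

/-- Interpolation preserves bounds for weighted sums of norms, as the nodal basis is a partition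
of unity. -/
theorem sum_norm_smul_gridInterp_le {ι : Type*} [Fintype ι] (hρ : 0 < ρ) (hK : 1 ≤ K)
    (ω : ι → ℝ) (f : ι → (Fin m → ℝ) → Fin e → ℝ) {A : ℝ}
    (hf : ∀ x, ∑ j, ‖ω j • f j x‖ ≤ A) {x : Fin m → ℝ} (hx : ‖x‖ ≤ ρ) :
    ∑ j, ‖ω j • gridInterp ρ K (f j) x‖ ≤ A := by
  calc _ ≤ ∑ j, ∑ ν, gridBasis ρ K ν x * ‖ω j • f j (gridNode ρ K ν)‖ := by
        refine sum_le_sum fun j _ => ?_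
        rw [gridInterp, smul_sum]
        refine norm_sum_le_of_le _ fun ν _ => ?_
        rw [smul_comm, norm_smul, Real.norm_eq_abs, abs_of_nonneg (gridBasis_nonneg ν x)]
    _ = ∑ ν, gridBasis ρ K ν x * ∑ j, ‖ω j • f j (gridNode ρ K ν)‖ := by
        rw [sum_comm]; simp only [mul_sum]
    _ ≤ ∑ ν, gridBasis ρ K ν x * A :=
        sum_le_sum fun ν _ => mul_le_mul_of_nonneg_left (hf _) (gridBasis_nonneg ν x)
    _ = A := by rw [← sum_mul, sum_gridBasis hρ hK hx, one_mul]

end Interp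

/-! ### Units and layers over arbitrary finite index types -/

section Units

variable {ι : Type*} [Fintype ι]

/-- `f` is an affine function of the variables, with at most `c` nonzero coefficients (the constant
term included). -/
def IsAffineUnit (f : (ι → ℝ) → ℝ) (c : ℕ) : Prop :=
  ∃ (w : ι → ℝ) (b : ℝ), (∀ v, f v = ∑ i, w i * v i + b) ∧
    Set.ncard {i | w i ≠ 0} + (if b ≠ 0 then 1 else 0) ≤ c

/-- `f` is a ReLU unit or a unit without activation, with at most `c` nonzero weights. -/
def IsReluUnit (f : (ι → ℝ) → ℝ) (c : ℕ) : Prop :=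
  ∃ g, IsAffineUnit g c ∧ (f = g ∨ f = fun v => max 0 (g v))

/-- `f` is an at most bilinear unit with at most `c` nonzero weights. -/
def IsBilinearUnit (f : (ι → ℝ) → ℝ) (c : ℕ) : Prop :=
  ∃ (B : ι → ι → ℝ) (w : ι → ℝ), (∀ v, f v = (∑ k, ∑ l, B k l * v k * v l) + ∑ i, w i * v i) ∧
    Set.ncard {p : ι × ι | B p.1 p.2 ≠ 0} + Set.ncard {i | w i ≠ 0} ≤ c

theorem ncard_add_ne_zero_le {α : Type*} [Finite α] (f g : α → ℝ) :
    Set.ncard {i | f i + g i ≠ 0} ≤ Set.ncard {i | f i ≠ 0} + Set.ncard {i | g i ≠ 0} := by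
  refine (Set.ncard_le_ncard ?_ (Set.toFinite _)).trans (Set.ncard_union_le _ _)
  intro i hi
  by_contra h
  simp only [Set.mem_union, Set.mem_ofPred_eq, not_or, not_not] at h
  exact hi (by simp [h.1, h.2])

theorem ncard_mul_ne_zero_le {α : Type*} [Finite α] (r : ℝ) (f : α → ℝ) :
    Set.ncard {i | r * f i ≠ 0} ≤ Set.ncard {i | f i ≠ 0} :=
  Set.ncard_le_ncard (fun _ hi => right_ne_zero_of_mul hi) (Set.toFinite _)

theorem IsAffineUnit.coord (i : ι) : IsAffineUnit (fun v : ι → ℝ => v i) 1 := by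
  classical
  refine ⟨Pi.single i 1, 0, fun v => by simp [Pi.single_apply], ?_⟩
  have : {k | (Pi.single i 1 : ι → ℝ) k ≠ 0} ⊆ {i} := fun k hk => by
    by_contra h; exact hk (Pi.single_eq_of_ne h _)
  simpa using Set.ncard_le_ncard this

theorem IsAffineUnit.const (b : ℝ) : IsAffineUnit (fun _ : ι → ℝ => b) 1 := by
  refine ⟨0, b, fun v => by simp, ?_⟩
  simp only [Pi.zero_apply, ne_eq, not_true_eq_false, Set.ofPred_false, Set.ncard_empty, zero_add]
  split_ifs <;> simp

theorem IsAffineUnit.add {f g : (ι → ℝ) → ℝ} {c c' : ℕ} (hf : IsAffineUnit f c)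
    (hg : IsAffineUnit g c') : IsAffineUnit (fun v => f v + g v) (c + c') := by
  obtain ⟨w, b, h, hc⟩ := hf
  obtain ⟨w', b', h', hc'⟩ := hg
  refine ⟨fun i => w i + w' i, b + b', fun v => ?_, ?_⟩
  · simp only [h, h', add_mul, sum_add_distrib]; ring
  · have h1 := ncard_add_ne_zero_le w w'
    have h2 : (if b + b' ≠ 0 then 1 else 0) ≤
        (if b ≠ 0 then 1 else 0) + (if b' ≠ 0 then 1 else 0) := by
      by_cases h3 : b = 0 <;> by_cases h4 : b' = 0 <;> simp [h3, h4]
      split_ifs <;> simp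
    change Set.ncard {i | w i + w' i ≠ 0} + _ ≤ _
    omega

theorem IsAffineUnit.smul {f : (ι → ℝ) → ℝ} {c : ℕ} (hf : IsAffineUnit f c) (r : ℝ) :
    IsAffineUnit (fun v => r * f v) c := by
  obtain ⟨w, b, h, hc⟩ := hf
  refine ⟨fun i => r * w i, r * b, fun v => ?_, ?_⟩
  · simp only [h, mul_add, mul_sum, mul_assoc]
  · have h1 := ncard_mul_ne_zero_le r w
    have h2 : (if r * b ≠ 0 then 1 else 0) ≤ (if b ≠ 0 then 1 else 0) := by
      by_cases h3 : b = 0 <;> simp [h3]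
      split_ifs <;> simp
    change Set.ncard {i | r * w i ≠ 0} + _ ≤ _
    omega

theorem IsAffineUnit.sub {f g : (ι → ℝ) → ℝ} {c c' : ℕ} (hf : IsAffineUnit f c)
    (hg : IsAffineUnit g c') : IsAffineUnit (fun v => f v - g v) (c + c') := by
  simpa [sub_eq_add_neg] using hf.add (hg.smul (-1))

theorem IsAffineUnit.reluUnit {f : (ι → ℝ) → ℝ} {c : ℕ} (hf : IsAffineUnit f c) :
    IsReluUnit f c := ⟨f, hf, Or.inl rfl⟩

theorem IsAffineUnit.relu {f : (ι → ℝ) → ℝ} {c : ℕ} (hf : IsAffineUnit f c) :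
    IsReluUnit (fun v => max 0 (f v)) c := ⟨f, hf, Or.inr rfl⟩

theorem IsBilinearUnit.coord (i : ι) : IsBilinearUnit (fun v : ι → ℝ => v i) 1 := by
  classical
  refine ⟨0, Pi.single i 1, fun v => by simp [Pi.single_apply], ?_⟩
  have : {k | (Pi.single i 1 : ι → ℝ) k ≠ 0} ⊆ {i} := fun k hk => by
    by_contra h; exact hk (Pi.single_eq_of_ne h _)
  simpa using Set.ncard_le_ncard this

theorem IsBilinearUnit.mul (i j : ι) : IsBilinearUnit (fun v : ι → ℝ => v i * v j) 1 := by
  classical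
  refine ⟨fun k l => if k = i then (if l = j then 1 else 0) else 0, 0, fun v => by simp, ?_⟩
  have : {p : ι × ι | (if p.1 = i then (if p.2 = j then (1 : ℝ) else 0) else 0) ≠ 0} ⊆
      {(i, j)} := by
    intro p hp
    simp only [ne_eq, ite_eq_right_iff, Set.mem_ofPred_eq, not_forall] at hp
    obtain ⟨h1, h2, -⟩ := hp
    exact Prod.ext h1 h2
  simpa using Set.ncard_le_ncard this

theorem IsBilinearUnit.zero : IsBilinearUnit (fun _ : ι → ℝ => 0) 0 :=
  ⟨0, 0, fun v => by simp, by simp⟩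

theorem IsBilinearUnit.add {f g : (ι → ℝ) → ℝ} {c c' : ℕ} (hf : IsBilinearUnit f c)
    (hg : IsBilinearUnit g c') : IsBilinearUnit (fun v => f v + g v) (c + c') := by
  obtain ⟨B, w, h, hc⟩ := hf
  obtain ⟨B', w', h', hc'⟩ := hg
  refine ⟨fun k l => B k l + B' k l, fun i => w i + w' i, fun v => ?_, ?_⟩
  · simp only [h, h', add_mul, sum_add_distrib]; ring
  · have h1 := ncard_add_ne_zero_le w w'
    have h2 := ncard_add_ne_zero_le (fun p : ι × ι => B p.1 p.2) (fun p => B' p.1 p.2)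
    change Set.ncard {p : ι × ι | B p.1 p.2 + B' p.1 p.2 ≠ 0} +
      Set.ncard {i | w i + w' i ≠ 0} ≤ _
    omega

theorem IsBilinearUnit.smul {f : (ι → ℝ) → ℝ} {c : ℕ} (hf : IsBilinearUnit f c) (r : ℝ) :
    IsBilinearUnit (fun v => r * f v) c := by
  obtain ⟨B, w, h, hc⟩ := hf
  refine ⟨fun k l => r * B k l, fun i => r * w i, fun v => ?_, ?_⟩
  · simp only [h, mul_add, mul_sum, mul_assoc]
  · have h1 := ncard_mul_ne_zero_le r w
    have h2 := ncard_mul_ne_zero_le r (fun p : ι × ι => B p.1 p.2)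
    change Set.ncard {p : ι × ι | r * B p.1 p.2 ≠ 0} + Set.ncard {i | r * w i ≠ 0} ≤ _
    omega

theorem IsBilinearUnit.sum {α : Type*} (s : Finset α) {f : α → (ι → ℝ) → ℝ} {c : ℕ}
    (hf : ∀ a, IsBilinearUnit (f a) c) : IsBilinearUnit (fun v => ∑ a ∈ s, f a v) (#s * c) := by
  classical
  induction s using Finset.induction_on with
  | empty => simpa using IsBilinearUnit.zero
  | insert a s ha ih =>
    simp only [sum_insert ha, card_insert_of_notMem ha]
    have := (hf a).add ih
    rwa [add_comm c, ← Nat.succ_mul] at this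

end Units

/-- The map `f` can be prepended to every network at the cost of at most `s` weights. The
enumerations of the variables are arbitrary, which makes the notion independent of the order in
which the units of a layer are listed. -/
def Prependable {ι κ : Type*} (f : (ι → ℝ) → κ → ℝ) (s : ℕ) : Prop :=
  ∀ ⦃d k e : ℕ⦄ (eι : ι ≃ Fin d) (eκ : κ ≃ Fin k) (net : Net k e), ∃ net' : Net d e,
    (∀ v : ι → ℝ, net'.eval (v ∘ eι.symm) = net.eval (f v ∘ eκ.symm)) ∧ net'.size ≤ s + net.size

section Layers

variable {ι κ μ : Type*} [Fintype ι] [Fintype κ] [Fintype μ]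

omit [Fintype ι] [Fintype κ] in
theorem Prependable.mono {f : (ι → ℝ) → κ → ℝ} {s s' : ℕ} (hf : Prependable f s) (h : s ≤ s') :
    Prependable f s' := by
  intro d k e eι eκ net
  obtain ⟨net', h1, h2⟩ := hf eι eκ net
  exact ⟨net', h1, by omega⟩

omit [Fintype ι] [Fintype μ] in
theorem Prependable.comp {g : (κ → ℝ) → μ → ℝ} {f : (ι → ℝ) → κ → ℝ} {s s' : ℕ}
    (hg : Prependable g s') (hf : Prependable f s) : Prependable (fun v => g (f v)) (s + s') := by
  intro d k e eι eμ net
  obtain ⟨net₁, h1, h2⟩ := hg (Fintype.equivFin κ) eμ net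
  obtain ⟨net₂, h3, h4⟩ := hf eι (Fintype.equivFin κ) net₁
  exact ⟨net₂, fun v => by rw [h3, h1], by omega⟩

theorem ncard_prod_le {α β : Type*} [Fintype α] [Finite β] (P : α → β → Prop) (c : α → ℕ)
    (h : ∀ a, Set.ncard {b | P a b} ≤ c a) :
    Set.ncard {p : α × β | P p.1 p.2} ≤ ∑ a, c a := by
  classical
  cases nonempty_fintype β
  have : {p : α × β | P p.1 p.2} = ↑(univ.filter fun p : α × β => P p.1 p.2) := by ext; simp
  rw [this, Set.ncard_coe_finset, card_filter, Fintype.sum_prod_type]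
  refine sum_le_sum fun a _ => ?_
  rw [← card_filter, ← Set.ncard_coe_finset]
  simpa using h a

theorem ncard_comp_equiv {α β : Type*} [Finite β] (e : α ≃ β) (P : β → Prop) :
    Set.ncard {a | P (e a)} = Set.ncard {b | P b} :=
  Set.ncard_congr (fun a _ => e a) (fun _ h => h) (fun _ _ _ _ h => e.injective h)
    (fun b hb => ⟨e.symm b, by simpa using hb, by simp⟩)

theorem Prependable.of_reluUnits {f : (ι → ℝ) → κ → ℝ} {c : κ → ℕ}
    (hf : ∀ k, IsReluUnit (fun v => f v k) (c k)) : Prependable f (∑ k, c k) := by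
  classical
  choose g hg hfg using hf
  choose w b hw hc using hg
  intro d k e eι eκ net
  refine ⟨.affine (fun i l => w (eκ.symm i) (eι.symm l)) (fun i => b (eκ.symm i))
    (fun i => decide ((fun v => f v (eκ.symm i)) = fun v => max 0 (g (eκ.symm i) v))) net, ?_, ?_⟩
  · intro v
    simp only [Net.eval]
    congr 1
    funext i
    have h1 : (Matrix.mulVec (fun i l => w (eκ.symm i) (eι.symm l)) (v ∘ eι.symm) i +
        b (eκ.symm i)) = g (eκ.symm i) v := by
      rw [hw]
      congr 1
      exact eι.symm.sum_comp fun l => w (eκ.symm i) l * v l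
    rw [h1]
    by_cases h : (fun v => f v (eκ.symm i)) = fun v => max 0 (g (eκ.symm i) v)
    · simpa [h] using (congrFun h v).symm
    · have h2 := (hfg (eκ.symm i)).resolve_right h
      simpa [h] using (congrFun h2 v).symm
  · simp only [Net.size]
    refine Nat.add_le_add_right ?_ _
    have h1 := ncard_prod_le (fun (i : Fin k) (l : Fin d) => w (eκ.symm i) (eι.symm l) ≠ 0)
      (fun i => Set.ncard {l | w (eκ.symm i) l ≠ 0})
      (fun i => (ncard_comp_equiv eι.symm fun l => w (eκ.symm i) l ≠ 0).le)
    have h2 : Set.ncard {i : Fin k | b (eκ.symm i) ≠ 0} =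
        ∑ i : Fin k, if b (eκ.symm i) ≠ 0 then 1 else 0 := by
      rw [← card_filter, ← Set.ncard_coe_finset]; simp
    rw [h2]
    refine (Nat.add_le_add_right h1 _).trans ?_
    rw [← sum_add_distrib, eκ.symm.sum_comp fun i => Set.ncard {l | w i l ≠ 0} +
      if b i ≠ 0 then 1 else 0]
    exact sum_le_sum fun i _ => hc i

theorem Prependable.of_bilinearUnits {f : (ι → ℝ) → κ → ℝ} {c : κ → ℕ}
    (hf : ∀ k, IsBilinearUnit (fun v => f v k) (c k)) : Prependable f (∑ k, c k) := by
  choose B w hw hc using hf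
  intro d k e eι eκ net
  refine ⟨.bilinear (fun i l l' => B (eκ.symm i) (eι.symm l) (eι.symm l'))
    (fun i l => w (eκ.symm i) (eι.symm l)) net, ?_, ?_⟩
  · intro v
    simp only [Net.eval]
    congr 1
    funext i
    simp only [Function.comp_apply, hw]
    congr 1
    · rw [← eι.symm.sum_comp]
      refine sum_congr rfl fun l _ => ?_
      rw [← eι.symm.sum_comp]
    · exact eι.symm.sum_comp fun l => w (eκ.symm i) l * v l
  · simp only [Net.size]
    refine Nat.add_le_add_right ?_ _
    have h1 := ncard_prod_le (fun (i : Fin k) (l : Fin d) => w (eκ.symm i) (eι.symm l) ≠ 0)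
      (fun i => Set.ncard {l | w (eκ.symm i) l ≠ 0})
      (fun i => (ncard_comp_equiv eι.symm fun l => w (eκ.symm i) l ≠ 0).le)
    have h2 := ncard_prod_le
      (fun (i : Fin k) (p : Fin d × Fin d) => B (eκ.symm i) (eι.symm p.1) (eι.symm p.2) ≠ 0)
      (fun i => Set.ncard {p : ι × ι | B (eκ.symm i) p.1 p.2 ≠ 0})
      (fun i => (ncard_comp_equiv (eι.symm.prodCongr eι.symm)
        fun p => B (eκ.symm i) p.1 p.2 ≠ 0).le)
    refine (Nat.add_le_add h2 h1).trans ?_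
    rw [← sum_add_distrib, eκ.symm.sum_comp fun i => Set.ncard {p : ι × ι | B i p.1 p.2 ≠ 0} +
      Set.ncard {l | w i l ≠ 0}]
    exact sum_le_sum fun i _ => hc i

theorem Prependable.id : Prependable (fun v : ι → ℝ => v) (Fintype.card ι) :=
  Prependable.mono (Prependable.of_reluUnits (f := fun v : ι → ℝ => v) (c := fun _ => 1)
    fun k => (IsAffineUnit.coord k).reluUnit) (by simp)

/-- Unused units with bias `1` raise the size of a network to any prescribed level, without
changing its realization. -/
theorem Net.exists_le_size {d e : ℕ} (net : Net d e) (q : ℕ) :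
    ∃ net' : Net d e, net'.eval = net.eval ∧ q ≤ net'.size ∧
      net'.size ≤ net.size + 2 * d + q := by
  refine ⟨.affine (k := d + q) (Matrix.of fun i j => if (i : ℕ) = j then 1 else 0)
    (fun i => if d ≤ i then 1 else 0) (fun _ => false)
    (.affine (k := d) (Matrix.of fun i j => if (i : ℕ) = j then 1 else 0)
      0 (fun _ => false) net), ?_, ?_⟩
  · funext x
    simp only [Net.eval]
    congr 1
    funext i
    simp [Matrix.mulVec, dotProduct, Fin.sum_univ_add, Fin.val_inj]
    have h1 : ¬ d ≤ (i : ℕ) := not_le.2 i.2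
    have h2 : ∀ l : Fin q, (i : ℕ) ≠ d + l := fun l => by have := i.2; omega
    simp [h1, h2]
  · simp only [Net.size]
    have h1 : Set.ncard {p : Fin (d + q) × Fin d |
        (Matrix.of fun (i : Fin (d + q)) (j : Fin d) => if (i : ℕ) = j then (1 : ℝ) else 0)
          p.1 p.2 ≠ 0} ≤ d := by
      refine (Set.ncard_le_ncard (t := (fun j : Fin d => (Fin.castAdd q j, j)) '' Set.univ)
        ?_ (Set.toFinite _)).trans ((Set.ncard_image_le (Set.toFinite _)).trans (by simp))
      rintro ⟨i, j⟩ h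
      simp only [Matrix.of_apply, Set.mem_ofPred_eq, ne_eq, ite_eq_right_iff, one_ne_zero,
        imp_false, not_not] at h
      exact ⟨j, trivial, Prod.ext (Fin.ext h.symm) rfl⟩
    have h2 : Set.ncard {p : Fin d × Fin (d + q) |
        (Matrix.of fun (i : Fin d) (j : Fin (d + q)) => if (i : ℕ) = j then (1 : ℝ) else 0)
          p.1 p.2 ≠ 0} ≤ d := by
      refine (Set.ncard_le_ncard (t := (fun j : Fin d => (j, Fin.castAdd q j)) '' Set.univ)
        ?_ (Set.toFinite _)).trans ((Set.ncard_image_le (Set.toFinite _)).trans (by simp))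
      rintro ⟨i, j⟩ h
      simp only [Matrix.of_apply, Set.mem_ofPred_eq, ne_eq, ite_eq_right_iff, one_ne_zero,
        imp_false, not_not] at h
      exact ⟨i, trivial, Prod.ext rfl (Fin.ext h)⟩
    have h3 : Set.ncard {i : Fin (d + q) | (if d ≤ (i : ℕ) then (1 : ℝ) else 0) ≠ 0} = q := by
      have : {i : Fin (d + q) | (if d ≤ (i : ℕ) then (1 : ℝ) else 0) ≠ 0} =
          (Fin.natAdd d : Fin q → Fin (d + q)) '' Set.univ := by
        ext i
        induction i using Fin.addCases with
        | left i =>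
          simp only [Set.mem_ofPred_eq, Fin.val_castAdd, ne_eq, ite_eq_right_iff, one_ne_zero,
            imp_false, Set.image_univ, Set.mem_range, not_le, i.2, not_true_eq_false,
            false_iff, not_exists]
          intro j hj
          have := congrArg Fin.val hj
          simp at this
          omega
        | right i => simp
      rw [this, Set.ncard_image_of_injective _ (Fin.natAdd_injective q d)]
      simp
    have h4 : Set.ncard {i : Fin d | (0 : Fin d → ℝ) i ≠ 0} = 0 := by simp
    rw [h3, h4]
    omega

end Layers

/-! ### Networks for one time step -/

section StepNet

variable {m dy : ℕ}

/-- The variables of the state `(t, x, y)`: the time is `none`. -/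
abbrev StateVar (m dy : ℕ) : Type := Option (Fin m ⊕ Fin dy)

/-- The state `(t, x, y)`. -/
def state (t : ℝ) (x : Fin m → ℝ) (y : Fin dy → ℝ) : StateVar m dy → ℝ :=
  fun o => o.elim t (Sum.elim x y)

/-- One step of the time-discretized flow, with clock `s ↦ ramp (α s - κ)` and with coefficients
`q` in the nodal basis. -/
def stepMap (ρ : ℝ) (K : ℕ) (α κ : ℝ) (q : Fin dy → (Fin m → Fin (K + 1)) → Fin m → ℝ)
    (v : StateVar m dy → ℝ) : StateVar m dy → ℝ :=
  state (v none)
    (fun i => v (some (.inl i)) + ∑ j, ∑ ν, q j ν i * (v (some (.inr j)) *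
      (ramp (α * v none - κ) * gridBasis ρ K ν fun p => v (some (.inl p)))))
    (fun j => v (some (.inr j)))

/-- The variables behind the second layer of a step: the state, the values of the one-dimensional
hat functions, and one variable per grid node. -/
abbrev NodeVar (m dy K : ℕ) : Type :=
  StateVar m dy ⊕ ((Fin m × Fin (K + 1)) ⊕ (Fin m → Fin (K + 1)))

/-- The variables behind the first layer of a step: the state, two ReLU units for the clock, and two
ReLU units per one-dimensional hat function. -/
abbrev ReluVar (m dy K : ℕ) : Type :=
  StateVar m dy ⊕ (Bool ⊕ (Fin m × Fin (K + 1)) × Bool)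

/-- The first layer of a step. -/
def reluLayer (ρ : ℝ) (K : ℕ) (α κ : ℝ) (v : StateVar m dy → ℝ) : ReluVar m dy K → ℝ :=
  Sum.elim v (Sum.elim
    (fun b => max 0 (α * v none - κ - if b then 1 else 0))
    (fun pb => max 0 ((if pb.2 then -1 else 1) *
      (gridDensity ρ K * v (some (.inl pb.1.1)) + gridDensity ρ K * ρ - (pb.1.2 : ℕ)))))

/-- The second layer of a step: it evaluates the hat functions, and initializes the variables of the
nodes with the clock. -/
def hatLayer (K : ℕ) (v : ReluVar m dy K → ℝ) : NodeVar m dy K → ℝ :=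
  Sum.elim (fun o => v (.inl o)) (Sum.elim
    (fun p => max 0 (1 - v (.inr (.inr (p, false))) - v (.inr (.inr (p, true)))))
    (fun _ => v (.inr (.inl false)) - v (.inr (.inl true))))

/-- Multiplication of the variables of the nodes by the hat functions in the directions `p ∈ s`. -/
def nodeProd (K : ℕ) (s : Finset (Fin m)) (v : NodeVar m dy K → ℝ) : NodeVar m dy K → ℝ :=
  Sum.elim (fun o => v (.inl o)) (Sum.elim (fun p => v (.inr (.inl p)))
    (fun ν => v (.inr (.inr ν)) * ∏ p ∈ s, v (.inr (.inl (p, ν p)))))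

/-- The last layer of a step. -/
def updateLayer (K : ℕ) (q : Fin dy → (Fin m → Fin (K + 1)) → Fin m → ℝ)
    (v : NodeVar m dy K → ℝ) : StateVar m dy → ℝ :=
  state (v (.inl none))
    (fun i => v (.inl (some (.inl i))) + ∑ j, ∑ ν, q j ν i * (v (.inl (some (.inr j))) *
      v (.inr (.inr ν))))
    (fun j => v (.inl (some (.inr j))))

theorem prependable_reluLayer (ρ : ℝ) (K : ℕ) (α κ : ℝ) :
    Prependable (reluLayer (m := m) (dy := dy) ρ K α κ) (m + dy + 7 + 4 * (m * (K + 1))) := by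
  refine Prependable.mono (Prependable.of_reluUnits
    (c := Sum.elim (fun _ => 1) (Sum.elim (fun _ => 3) (fun _ => 2))) ?_) ?_
  · rintro (o | b | ⟨⟨p, ν⟩, b⟩)
    · exact (IsAffineUnit.coord o).reluUnit
    · exact ((((IsAffineUnit.coord none).smul α).sub (IsAffineUnit.const κ)).sub
        (IsAffineUnit.const (if b then 1 else 0))).relu
    · have h := ((((IsAffineUnit.coord (some (Sum.inl p) : StateVar m dy)).smul
        (gridDensity ρ K)).add (IsAffineUnit.const (gridDensity ρ K * ρ - (ν : ℕ)))).smul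
          (if b then -1 else 1)).relu
      simpa only [reluLayer, Sum.elim_inr, add_sub_assoc] using h
  · simp
    ring_nf
    omega

theorem prependable_hatLayer (K : ℕ) :
    Prependable (hatLayer (m := m) (dy := dy) K)
      (m + dy + 1 + 3 * (m * (K + 1)) + 2 * (K + 1) ^ m) := by
  refine Prependable.mono (Prependable.of_reluUnits
    (c := Sum.elim (fun _ => 1) (Sum.elim (fun _ => 3) (fun _ => 2))) ?_) ?_
  · rintro (o | p | ν)
    · exact (IsAffineUnit.coord _).reluUnit
    · exact (((IsAffineUnit.const 1).sub (IsAffineUnit.coord _)).sub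
        (IsAffineUnit.coord _)).relu
    · exact ((IsAffineUnit.coord _).sub (IsAffineUnit.coord _)).reluUnit
  · simp
    ring_nf
    omega

theorem prependable_nodeProd_singleton (K : ℕ) (p : Fin m) :
    Prependable (nodeProd (m := m) (dy := dy) K {p})
      (m + dy + 1 + m * (K + 1) + (K + 1) ^ m) := by
  refine Prependable.mono (Prependable.of_bilinearUnits
    (c := Sum.elim (fun _ => 1) (Sum.elim (fun _ => 1) (fun _ => 1))) ?_) ?_
  · rintro (o | p' | ν)
    · exact IsBilinearUnit.coord _
    · exact IsBilinearUnit.coord _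
    · simpa only [nodeProd, prod_singleton, Sum.elim_inr] using IsBilinearUnit.mul _ _
  · simp
    ring_nf
    omega

theorem prependable_nodeProd (K : ℕ) (s : Finset (Fin m)) :
    Prependable (nodeProd (m := m) (dy := dy) K s)
      ((#s + 1) * (m + dy + 1 + m * (K + 1) + (K + 1) ^ m)) := by
  induction s using Finset.induction_on with
  | empty =>
    have : nodeProd (m := m) (dy := dy) K ∅ = fun v => v := by
      funext v k
      rcases k with o | p | ν <;> simp [nodeProd]
    rw [this]
    refine Prependable.id.mono ?_
    simp
    ring_nf
    omega
  | insert p s hp ih =>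
    have : nodeProd (m := m) (dy := dy) K (insert p s) =
        fun v => nodeProd K {p} (nodeProd K s v) := by
      funext v k
      rcases k with o | p' | ν
      · rfl
      · rfl
      · simp only [nodeProd, Sum.elim_inr, Sum.elim_inl, prod_insert hp, prod_singleton]
        ring
    rw [this, card_insert_of_notMem hp]
    refine Prependable.mono ((prependable_nodeProd_singleton K p).comp ih) (le_of_eq ?_)
    ring

theorem prependable_updateLayer (K : ℕ) (q : Fin dy → (Fin m → Fin (K + 1)) → Fin m → ℝ) :
    Prependable (updateLayer K q) (m + dy + 1 + m * (dy * (K + 1) ^ m)) := by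
  refine Prependable.mono (Prependable.of_bilinearUnits
    (c := fun o : StateVar m dy => o.elim 1 (Sum.elim (fun _ => 1 + dy * (K + 1) ^ m) (fun _ => 1))) ?_) ?_
  · rintro (- | i | j)
    · exact IsBilinearUnit.coord _
    · have := (IsBilinearUnit.coord (Sum.inl (some (Sum.inl i)) : NodeVar m dy K)).add
        (IsBilinearUnit.sum univ fun j => IsBilinearUnit.sum univ fun ν =>
          (IsBilinearUnit.mul (Sum.inl (some (Sum.inr j)) : NodeVar m dy K)
            (Sum.inr (Sum.inr ν))).smul (q j ν i))
      simpa [updateLayer, state] using this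
    · exact IsBilinearUnit.coord _
  · simp
    ring_nf
    omega

theorem updateLayer_nodeProd (ρ : ℝ) (K : ℕ) (α κ : ℝ)
    (q : Fin dy → (Fin m → Fin (K + 1)) → Fin m → ℝ) (v : StateVar m dy → ℝ) :
    updateLayer K q (nodeProd K univ (hatLayer K (reluLayer ρ K α κ v))) =
      stepMap ρ K α κ q v := by
  simp [updateLayer, nodeProd, hatLayer, reluLayer, stepMap, gridBasis, hat, ramp]

/-- One time step costs a number of weights proportional to the number of parameters times the
number of grid nodes. -/
theorem prependable_stepMap (hdy : 1 ≤ dy) (ρ : ℝ) (K : ℕ) (α κ : ℝ)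
    (q : Fin dy → (Fin m → Fin (K + 1)) → Fin m → ℝ) :
    Prependable (stepMap ρ K α κ q) (20 * (m + 2) ^ 2 * (dy * (K + 1) ^ m)) := by
  rcases Nat.eq_zero_or_pos m with rfl | hm
  · refine Prependable.mono (f := stepMap ρ K α κ q) (s := dy + 1) ?_ ?_
    · have : stepMap ρ K α κ q = fun v => v := by
        funext v o
        rcases o with - | i | j
        · rfl
        · exact i.elim0
        · rfl
      rw [this]
      refine Prependable.id.mono ?_
      simp
    · simp; omega
  have h := (prependable_updateLayer (m := m) K q).comp ((prependable_nodeProd K univ).comp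
    ((prependable_hatLayer K).comp (prependable_reluLayer (m := m) (dy := dy) ρ K α κ)))
  simp only [updateLayer_nodeProd] at h
  refine Prependable.mono h ?_
  rw [card_fin]
  set X := dy * (K + 1) ^ m with hX
  have h0 : K + 1 ≤ (K + 1) ^ m := Nat.le_self_pow (by omega) _
  have h1 : (K + 1) ^ m ≤ X := Nat.le_mul_of_pos_left _ hdy
  have h2 : dy ≤ X := Nat.le_mul_of_pos_right _ (by positivity)
  have h3 : 1 ≤ X := hdy.trans h2
  have h4 : m * (K + 1) ≤ m * X := Nat.mul_le_mul_left _ (h0.trans h1)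
  have h5 : m ≤ m * X := Nat.le_mul_of_pos_right _ h3
  have h6 : (m + 1) * (m + dy + 1 + m * (K + 1) + (K + 1) ^ m) ≤
      (m + 1) * ((2 * m + 3) * X) := Nat.mul_le_mul_left _ (by linarith)
  nlinarith

end StepNet

/-! ### The time-discretized flow -/

section Euler

variable {m dy : ℕ}

/-- The velocity `∑ j, y_j ω_j f_j(u)`. -/
def velocity (ω : Fin dy → ℝ) (f : Fin dy → (Fin m → ℝ) → Fin m → ℝ) (y : Fin dy → ℝ)
    (u : Fin m → ℝ) : Fin m → ℝ :=
  ∑ j, (y j * ω j) • f j u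

/-- A step of the explicit Euler method with step size `h`, of which only the fraction `τ` is
carried out. -/
def eulerStep (h : ℝ) (ω : Fin dy → ℝ) (f : Fin dy → (Fin m → ℝ) → Fin m → ℝ) (τ : ℝ)
    (y : Fin dy → ℝ) (u : Fin m → ℝ) : Fin m → ℝ :=
  u + (τ * h) • velocity ω f y u

/-- The composition of the `r` Euler steps with the numbers `k, ..., k + r - 1`. -/
def euler (h : ℝ) (ω : Fin dy → ℝ) (f : ℕ → Fin dy → (Fin m → ℝ) → Fin m → ℝ) (τ : ℕ → ℝ)
    (y : Fin dy → ℝ) : ℕ → ℕ → (Fin m → ℝ) → Fin m → ℝ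
  | _, 0, u => u
  | k, r + 1, u => euler h ω f τ y (k + 1) r (eulerStep h ω (f k) (τ k) y u)

theorem euler_succ (h : ℝ) (ω : Fin dy → ℝ) (f : ℕ → Fin dy → (Fin m → ℝ) → Fin m → ℝ)
    (τ : ℕ → ℝ) (y : Fin dy → ℝ) (k r : ℕ) (u : Fin m → ℝ) :
    euler h ω f τ y k (r + 1) u =
      eulerStep h ω (f (k + r)) (τ (k + r)) y (euler h ω f τ y k r u) := by
  induction r generalizing k u with
  | zero => rfl
  | succ r ih =>
    change euler h ω f τ y (k + 1) (r + 1) _ = _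
    rw [ih, add_right_comm k 1 r, add_assoc k r 1]
    rfl

end Euler

/-! ### Networks for the time-discretized flow -/

section EulerNet

variable {m dy : ℕ}

theorem stepMap_state (ρ : ℝ) (K : ℕ) (α κ h : ℝ) (ω : Fin dy → ℝ)
    (f : Fin dy → (Fin m → ℝ) → Fin m → ℝ) (t : ℝ) (x : Fin m → ℝ) (y : Fin dy → ℝ) :
    stepMap ρ K α κ (fun j ν i => h * ω j * f j (gridNode ρ K ν) i) (state t x y) =
      state t (eulerStep h ω (fun j => gridInterp ρ K (f j)) (ramp (α * t - κ)) y x) y := by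
  funext o
  rcases o with - | i | j
  · rfl
  · simp only [stepMap, state, eulerStep, velocity, gridInterp, Option.elim, Sum.elim_inl,
      Sum.elim_inr, Pi.add_apply, Pi.smul_apply, Finset.sum_apply, smul_eq_mul, mul_sum]
    congr 1
    refine sum_congr rfl fun j _ => sum_congr rfl fun ν _ => ?_
    ring
  · rfl

theorem prependable_euler (hdy : 1 ≤ dy) (ρ : ℝ) (K : ℕ) (α h : ℝ) (ω : Fin dy → ℝ)
    (f : ℕ → Fin dy → (Fin m → ℝ) → Fin m → ℝ) (k r : ℕ) :
    ∃ F : (StateVar m dy → ℝ) → StateVar m dy → ℝ,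
      Prependable F (m + dy + 1 + r * (20 * (m + 2) ^ 2 * (dy * (K + 1) ^ m))) ∧
      ∀ t x y, F (state t x y) =
        state t (euler h ω (fun k j => gridInterp ρ K (f k j)) (fun k => ramp (α * t - k)) y k r x)
          y := by
  induction r generalizing k with
  | zero => exact ⟨fun v => v, Prependable.id.mono (by simp), fun t x y => rfl⟩
  | succ r ih =>
    obtain ⟨F, hF, hFe⟩ := ih (k + 1)
    refine ⟨_, (hF.comp (prependable_stepMap hdy ρ K α k
      (fun j ν i => h * ω j * f k j (gridNode ρ K ν) i))).mono (le_of_eq (by ring)), ?_⟩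
    intro t x y
    rw [stepMap_state, hFe]
    rfl

/-- The enumeration of the state variables used by `Net.evalTXY`. -/
def stateEquiv (m dy : ℕ) : StateVar m dy ≃ Fin (m + dy + 1) :=
  (Equiv.optionCongr finSumFinEquiv).trans (finSuccEquiv (m + dy)).symm

theorem state_comp_stateEquiv_symm (t : ℝ) (x : Fin m → ℝ) (y : Fin dy → ℝ) :
    state t x y ∘ (stateEquiv m dy).symm = Fin.cons t (Fin.append x y) := by
  refine (Equiv.comp_symm_eq (stateEquiv m dy) _ _).2 ?_
  funext o
  rcases o with - | i | j <;> simp [stateEquiv, state]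

/-- The network with a single layer, which returns the spatial part `x` of the input. -/
def projNet (m dy : ℕ) : Net (m + dy + 1) m :=
  .output (Matrix.of fun i j => if j = stateEquiv m dy (some (.inl i)) then 1 else 0)

theorem eval_projNet (v : StateVar m dy → ℝ) :
    (projNet m dy).eval (v ∘ (stateEquiv m dy).symm) = fun i => v (some (.inl i)) := by
  funext i
  simp [projNet, Net.eval, Matrix.mulVec, dotProduct]

theorem evalTXY_projNet (t : ℝ) (x : Fin m → ℝ) (y : Fin dy → ℝ) :
    (projNet m dy).evalTXY t x y = x := by
  rw [Net.evalTXY, ← state_comp_stateEquiv_symm, eval_projNet]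
  rfl

theorem size_projNet_le : (projNet m dy).size ≤ m :=
  (ncard_prod_le (fun (i : Fin m) (j : Fin (m + dy + 1)) =>
    (Matrix.of fun (i : Fin m) (j : Fin (m + dy + 1)) =>
      if j = stateEquiv m dy (some (.inl i)) then (1 : ℝ) else 0) i j ≠ 0) (fun _ => 1)
    fun i => by simp).trans (by simp)

/-- The time-discretized flow with interpolated velocity components is realized exactly by a
network. -/
theorem exists_net_euler (hdy : 1 ≤ dy) (ρ : ℝ) (K : ℕ) (α h : ℝ) (ω : Fin dy → ℝ)
    (f : ℕ → Fin dy → (Fin m → ℝ) → Fin m → ℝ) (n : ℕ) :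
    ∃ net : Net (m + dy + 1) m,
      (∀ t x y, net.evalTXY t x y =
        euler h ω (fun k j => gridInterp ρ K (f k j)) (fun k => ramp (α * t - k)) y 0 n x) ∧
      net.size ≤ (n + 1) * (20 * (m + 2) ^ 2 * (dy * (K + 1) ^ m)) := by
  obtain ⟨F, hF, hFe⟩ := prependable_euler hdy ρ K α h ω f 0 n
  obtain ⟨net, h1, h2⟩ := hF (stateEquiv m dy) (stateEquiv m dy) (projNet m dy)
  refine ⟨net, fun t x y => ?_, h2.trans ?_⟩
  · rw [Net.evalTXY, ← state_comp_stateEquiv_symm, h1, hFe, eval_projNet]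
    rfl
  · have h3 : (projNet m dy).size ≤ m := size_projNet_le
    have h4 : dy ≤ dy * (K + 1) ^ m := Nat.le_mul_of_pos_right _ (by positivity)
    have h5 : m + dy + 1 + m ≤ 20 * (m + 2) ^ 2 * (dy * (K + 1) ^ m) := by
      set X := dy * (K + 1) ^ m
      have : m * 1 ≤ m * X := Nat.mul_le_mul_left _ (hdy.trans h4)
      nlinarith
    rw [add_mul, one_mul]
    omega

end EulerNet

/-! ### Stability of the time-discretized flow -/

section Stability

variable {m dy : ℕ}

theorem norm_velocity_le {ω : Fin dy → ℝ} {f : Fin dy → (Fin m → ℝ) → Fin m → ℝ}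
    {y : Fin dy → ℝ} {u : Fin m → ℝ} {A : ℝ} (hA : ∑ j, ‖ω j • f j u‖ ≤ A) :
    ‖velocity ω f y u‖ ≤ A * ‖y‖ := by
  calc ‖velocity ω f y u‖ ≤ ∑ j, ‖ω j • f j u‖ * ‖y‖ := by
        refine norm_sum_le_of_le _ fun j _ => ?_
        rw [mul_smul, norm_smul, mul_comm]
        exact mul_le_mul_of_nonneg_left (norm_le_pi_norm y j) (norm_nonneg _)
    _ ≤ A * ‖y‖ := by rw [← sum_mul]; exact mul_le_mul_of_nonneg_right hA (norm_nonneg _)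

theorem norm_eulerStep_sub_self_le {h : ℝ} (hh : 0 ≤ h) {ω : Fin dy → ℝ}
    {f : Fin dy → (Fin m → ℝ) → Fin m → ℝ}
    {y : Fin dy → ℝ} (hy : ‖y‖ ≤ 1) {u : Fin m → ℝ} {A : ℝ} (hA0 : 0 ≤ A)
    (hA : ∑ j, ‖ω j • f j u‖ ≤ A) {τ : ℝ} (hτ0 : 0 ≤ τ) :
    ‖eulerStep h ω f τ y u - u‖ ≤ τ * h * A := by
  rw [eulerStep, add_sub_cancel_left, norm_smul, Real.norm_eq_abs, abs_of_nonneg (by positivity)]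
  exact mul_le_mul_of_nonneg_left ((norm_velocity_le hA).trans
    (mul_le_of_le_one_right hA0 hy)) (by positivity)

theorem norm_eulerStep_le {h : ℝ} (hh : 0 ≤ h) {ω : Fin dy → ℝ}
    {f : Fin dy → (Fin m → ℝ) → Fin m → ℝ}
    {y : Fin dy → ℝ} (hy : ‖y‖ ≤ 1) {u : Fin m → ℝ} {A : ℝ} (hA0 : 0 ≤ A)
    (hA : ∑ j, ‖ω j • f j u‖ ≤ A) {τ : ℝ} (hτ0 : 0 ≤ τ) (hτ1 : τ ≤ 1) :
    ‖eulerStep h ω f τ y u‖ ≤ ‖u‖ + h * A := by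
  have h1 := norm_eulerStep_sub_self_le hh hy hA0 hA hτ0
  have h2 := norm_le_norm_sub_add (eulerStep h ω f τ y u) u
  have h3 : τ * (h * A) ≤ h * A := mul_le_of_le_one_left (by positivity) hτ1
  linarith

/-- The stability of an Euler step, in terms of a bound `Δ` for the differences of the velocity
components, scaled by the total weight `∑ j, ω j`. -/
theorem norm_eulerStep_sub_le {h : ℝ} (hh : 0 ≤ h) {ω : Fin dy → ℝ} (hω : ∀ j, 0 ≤ ω j)
    {f : Fin dy → (Fin m → ℝ) → Fin m → ℝ} {y y' : Fin dy → ℝ} (hy : ‖y‖ ≤ 1)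
    {u u' : Fin m → ℝ} {A Δ : ℝ} (hA : ∑ j, ‖ω j • f j u'‖ ≤ A) (hΔ0 : 0 ≤ Δ)
    (hΔ : ∀ j, h * (∑ j, ω j) * ‖f j u - f j u'‖ ≤ Δ) {τ : ℝ} (hτ0 : 0 ≤ τ) (hτ1 : τ ≤ 1) :
    ‖eulerStep h ω f τ y u - eulerStep h ω f τ y' u'‖ ≤ ‖u - u'‖ + Δ + h * A * ‖y - y'‖ := by
  have hA0 : 0 ≤ A := (sum_nonneg fun j _ => norm_nonneg _).trans hA
  have hW0 : 0 ≤ ∑ j, ω j := sum_nonneg fun j _ => hω j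
  have key : velocity ω f y u - velocity ω f y' u' =
      (∑ j, (y j * ω j) • (f j u - f j u')) + velocity ω f (y - y') u' := by
    simp only [velocity, Pi.sub_apply, sub_mul, sub_smul, smul_sub, sum_sub_distrib]
    abel
  have h1 : ‖h • ∑ j, (y j * ω j) • (f j u - f j u')‖ ≤ Δ := by
    rw [norm_smul, Real.norm_eq_abs, abs_of_nonneg hh]
    have h2 : ‖∑ j, (y j * ω j) • (f j u - f j u')‖ ≤ ∑ j, ω j * ‖f j u - f j u'‖ := by
      refine norm_sum_le_of_le _ fun j _ => ?_
      rw [norm_smul, norm_mul, Real.norm_eq_abs (ω j), abs_of_nonneg (hω j)]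
      exact mul_le_mul_of_nonneg_right (mul_le_of_le_one_left (hω j)
        ((norm_le_pi_norm y j).trans hy)) (norm_nonneg _)
    rcases hW0.eq_or_lt with hW | hW
    · have h3 : ∀ j, ω j = 0 := fun j =>
        (sum_eq_zero_iff_of_nonneg fun j _ => hω j).1 hW.symm j (mem_univ j)
      simpa [h3] using hΔ0
    · refine le_of_mul_le_mul_left ?_ hW
      calc (∑ j, ω j) * (h * ‖∑ j, (y j * ω j) • (f j u - f j u')‖) ≤
            (∑ j, ω j) * (h * ∑ j, ω j * ‖f j u - f j u'‖) := by gcongr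
        _ = ∑ j, ω j * (h * (∑ j, ω j) * ‖f j u - f j u'‖) := by
            generalize ∑ j, ω j = W
            rw [mul_sum, mul_sum]
            exact sum_congr rfl fun j _ => by ring
        _ ≤ ∑ j, ω j * Δ := sum_le_sum fun j _ => mul_le_mul_of_nonneg_left (hΔ j) (hω j)
        _ = (∑ j, ω j) * Δ := by rw [sum_mul]
  have h2 : ‖h • velocity ω f (y - y') u'‖ ≤ h * A * ‖y - y'‖ := by
    rw [norm_smul, Real.norm_eq_abs, abs_of_nonneg hh, mul_assoc]
    exact mul_le_mul_of_nonneg_left (norm_velocity_le hA) hh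
  have h3 : eulerStep h ω f τ y u - eulerStep h ω f τ y' u' =
      (u - u') + τ • (h • (velocity ω f y u - velocity ω f y' u')) := by
    simp only [eulerStep, mul_smul, smul_sub]; abel
  rw [h3, add_assoc]
  refine (norm_add_le _ _).trans (add_le_add le_rfl ?_)
  rw [norm_smul, Real.norm_eq_abs, abs_of_nonneg hτ0]
  refine (mul_le_of_le_one_left (norm_nonneg _) hτ1).trans ?_
  rw [key, smul_add]
  exact (norm_add_le _ _).trans (add_le_add h1 h2)

/-- The hypotheses on the velocity components `f k j` of the time-discretized flow: the weighted sum
of their norms is at most `A`, and they have the Lipschitz constant `M`, on the ball of radius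
`ρ`. -/
structure VelocityBounds (ω : Fin dy → ℝ) (f : ℕ → Fin dy → (Fin m → ℝ) → Fin m → ℝ)
    (ρ A M : ℝ) : Prop where
  weight_nonneg : ∀ j, 0 ≤ ω j
  lip_nonneg : 0 ≤ M
  bound : ∀ k u, ‖u‖ ≤ ρ → ∑ j, ‖ω j • f k j u‖ ≤ A
  lip : ∀ k j u u', ‖u‖ ≤ ρ → ‖u'‖ ≤ ρ → ‖f k j u - f k j u'‖ ≤ M * ‖u - u'‖

variable {h : ℝ} {ω : Fin dy → ℝ} {f : ℕ → Fin dy → (Fin m → ℝ) → Fin m → ℝ} {τ : ℕ → ℝ}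
  {ρ A M : ℝ}

theorem VelocityBounds.norm_eulerStep_sub_le (hf : VelocityBounds ω f ρ A M) (hh : 0 ≤ h)
    (hτ0 : ∀ k, 0 ≤ τ k) (hτ1 : ∀ k, τ k ≤ 1) (k : ℕ) {y y' : Fin dy → ℝ}
    (hy : ‖y‖ ≤ 1) {u u' : Fin m → ℝ} (hu : ‖u‖ ≤ ρ) (hu' : ‖u'‖ ≤ ρ) :
    ‖eulerStep h ω (f k) (τ k) y u - eulerStep h ω (f k) (τ k) y' u'‖ ≤
      (1 + h * (∑ j, ω j) * M) * ‖u - u'‖ + h * A * ‖y - y'‖ := by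
  have hW0 : 0 ≤ ∑ j, ω j := sum_nonneg fun j _ => hf.weight_nonneg j
  have hM := hf.lip_nonneg
  have := TransportDNN.norm_eulerStep_sub_le hh hf.weight_nonneg (y' := y') hy (hf.bound k u' hu')
    (Δ := h * (∑ j, ω j) * (M * ‖u - u'‖)) (by positivity)
    (fun j => mul_le_mul_of_nonneg_left (hf.lip k j u u' hu hu') (by positivity)) (hτ0 k) (hτ1 k)
  linarith

theorem VelocityBounds.norm_euler_sub_le (hf : VelocityBounds ω f ρ A M) (hh : 0 ≤ h)
    (hA0 : 0 ≤ A) (hτ0 : ∀ k, 0 ≤ τ k) (hτ1 : ∀ k, τ k ≤ 1) {y y' : Fin dy → ℝ}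
    (hy : ‖y‖ ≤ 1) (hy' : ‖y'‖ ≤ 1) (r : ℕ) :
    ∀ (k : ℕ) {R : ℝ} {u u' : Fin m → ℝ}, ‖u‖ ≤ R → ‖u'‖ ≤ R → R + r * (h * A) ≤ ρ →
    ‖euler h ω f τ y k r u - euler h ω f τ y' k r u'‖ ≤
      (1 + h * (∑ j, ω j) * M) ^ r * (‖u - u'‖ + r * (h * A) * ‖y - y'‖) := by
  have hW0 : 0 ≤ ∑ j, ω j := sum_nonneg fun j _ => hf.weight_nonneg j
  have hM := hf.lip_nonneg
  have hhA : 0 ≤ h * A := by positivity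
  induction r with
  | zero => intro k R u u' _ _ _; simp [euler]
  | succ r ih =>
    intro k R u u' hu hu' hR
    push_cast at hR
    have hr : 0 ≤ (r : ℝ) * (h * A) := by positivity
    have hRρ : R ≤ ρ := by linarith
    have h1 := hf.norm_eulerStep_sub_le (y' := y') hh hτ0 hτ1 k hy (hu.trans hRρ) (hu'.trans hRρ)
    have h2 := ih (k + 1) (R := R + h * A) (u := eulerStep h ω (f k) (τ k) y u)
      (u' := eulerStep h ω (f k) (τ k) y' u')
      ((norm_eulerStep_le hh hy hA0 (hf.bound k u (hu.trans hRρ)) (hτ0 k) (hτ1 k)).trans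
        (by linarith))
      ((norm_eulerStep_le hh hy' hA0 (hf.bound k u' (hu'.trans hRρ)) (hτ0 k) (hτ1 k)).trans
        (by linarith)) (by linarith)
    refine h2.trans ?_
    rw [pow_succ, mul_assoc (_ ^ r)]
    refine mul_le_mul_of_nonneg_left ?_ (by positivity)
    have h3 : 0 ≤ h * (∑ j, ω j) * M * (((r : ℝ) + 1) * (h * A) * ‖y - y'‖) := by positivity
    push_cast
    linarith

end Stability

/-! ### Norms, sparsity and complexity of factors -/

section Factors

variable {d e : ℕ}

theorem numVars_le_of_subset {v : (Fin d → ℝ) → ℝ} {s : Set (Fin d)}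
    (h : ∀ k ∉ s, ∀ x c, v (Function.update x k c) = v x) : numVars v ≤ s.ncard := by
  refine Set.ncard_le_ncard (fun k hk => ?_) (Set.toFinite _)
  obtain ⟨x, c, hxc⟩ := hk
  by_contra hks
  exact hxc (h k hks x c)

theorem numVars_le (v : (Fin d → ℝ) → ℝ) : numVars v ≤ d :=
  (numVars_le_of_subset (s := Set.univ) (by simp)).trans (by simp)

theorem numVars_coord_le (i : Fin d) : numVars (fun x : Fin d → ℝ => x i) ≤ 1 :=
  (numVars_le_of_subset (s := {i}) fun k hk x c => Function.update_of_ne (Ne.symm hk) c x).trans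
    (by simp)

theorem factorSparsity_le_of_isMultilin {g : (Fin d → ℝ) → Fin e → ℝ} (hg : IsMultilin g) :
    factorSparsity g ≤ 1 := by
  unfold factorSparsity
  split_ifs <;> simp

theorem factorSparsity_le {g : (Fin d → ℝ) → Fin e → ℝ} {s : ℕ} (hs : 1 ≤ s)
    (hg : ∀ i, numVars (fun x => g x i) ≤ s) : factorSparsity g ≤ s := by
  unfold factorSparsity
  split_ifs
  · exact Nat.zero_le _
  · exact hs
  · exact Finset.sup_le fun i _ => hg i

theorem lipSemiOn_le {D : Set (Fin d → ℝ)} {g : (Fin d → ℝ) → Fin e → ℝ} {B : ℝ} (hB : 0 ≤ B)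
    (h : ∀ x ∈ D, ∀ x' ∈ D, ‖g x - g x'‖ ≤ B * ‖x - x'‖) : lipSemiOn D g ≤ ENNReal.ofReal B := by
  refine iSup₂_le fun x hx => iSup₂_le fun x' hx' => ENNReal.div_le_of_le_mul ?_
  rw [edist_dist, edist_dist, ← ENNReal.ofReal_mul hB, dist_eq_norm, dist_eq_norm]
  exact ENNReal.ofReal_le_ofReal (h x hx x' hx')

theorem lipNormOn_le {D : Set (Fin d → ℝ)} {g : (Fin d → ℝ) → Fin e → ℝ} {B : ℝ} (hB : 0 ≤ B)
    (h0 : ∀ x ∈ D, ‖g x‖ ≤ B) (h : ∀ x ∈ D, ∀ x' ∈ D, ‖g x - g x'‖ ≤ B * ‖x - x'‖) :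
    lipNormOn D g ≤ ENNReal.ofReal B := by
  refine max_le (iSup₂_le fun x hx => ?_) (lipSemiOn_le hB h)
  rw [← ofReal_norm]
  exact ENNReal.ofReal_le_ofReal (h0 x hx)

/-- The function `φ` is affine. -/
def IsAffineInOne (φ : ℝ → ℝ) : Prop := ∃ p q : ℝ, ∀ c, φ c = p + c * q

theorem IsAffineInOne.add {φ ψ : ℝ → ℝ} (hφ : IsAffineInOne φ) (hψ : IsAffineInOne ψ) :
    IsAffineInOne fun c => φ c + ψ c := by
  obtain ⟨p, q, h⟩ := hφ
  obtain ⟨p', q', h'⟩ := hψ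
  exact ⟨p + p', q + q', fun c => by simp only [h, h']; ring⟩

theorem IsAffineInOne.smul {φ : ℝ → ℝ} (r : ℝ) (hφ : IsAffineInOne φ) :
    IsAffineInOne fun c => r * φ c := by
  obtain ⟨p, q, h⟩ := hφ
  exact ⟨r * p, r * q, fun c => by simp only [h]; ring⟩

theorem IsAffineInOne.sum {α : Type*} (s : Finset α) {φ : α → ℝ → ℝ}
    (hφ : ∀ a, IsAffineInOne (φ a)) : IsAffineInOne fun c => ∑ a ∈ s, φ a c := by
  choose p q h using hφ
  exact ⟨∑ a ∈ s, p a, ∑ a ∈ s, q a, fun c => by simp [h, sum_add_distrib, mul_sum]⟩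

theorem isAffineInOne_coord (x : Fin d → ℝ) (k i : Fin d) :
    IsAffineInOne fun c => Function.update x k c i := by
  by_cases h : i = k
  · subst h; exact ⟨0, 1, fun c => by simp⟩
  · exact ⟨x i, 0, fun c => by simp [h]⟩

theorem isAffineInOne_coord_mul_coord (x : Fin d → ℝ) (k : Fin d) {i j : Fin d} (hij : i ≠ j) :
    IsAffineInOne fun c => Function.update x k c i * Function.update x k c j := by
  by_cases h : i = k
  · subst h; exact ⟨0, x j, fun c => by simp [hij.symm]⟩
  · by_cases h' : j = k
    · subst h'; exact ⟨0, x i, fun c => by simp [h]; ring⟩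
    · exact ⟨x i * x j, 0, fun c => by simp [h, h']⟩

end Factors

/-! ### A stable representation of the time-discretized flow -/

section FlowRep

variable {m dy : ℕ}

/-- The first block of a vector. -/
def fstPart {k l : ℕ} (v : Fin (k + l) → ℝ) (i : Fin k) : ℝ := v (Fin.castAdd l i)

/-- The second block of a vector. -/
def sndPart {k l : ℕ} (v : Fin (k + l) → ℝ) (j : Fin l) : ℝ := v (Fin.natAdd k j)

@[simp] theorem fstPart_append {k l : ℕ} (a : Fin k → ℝ) (b : Fin l → ℝ) :
    fstPart (Fin.append a b) = a := by funext i; simp [fstPart]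

@[simp] theorem sndPart_append {k l : ℕ} (a : Fin k → ℝ) (b : Fin l → ℝ) :
    sndPart (Fin.append a b) = b := by funext i; simp [sndPart]

theorem norm_fstPart_le {k l : ℕ} (v : Fin (k + l) → ℝ) : ‖fstPart v‖ ≤ ‖v‖ :=
  (pi_norm_le_iff_of_nonneg (norm_nonneg _)).2 fun _ => norm_le_pi_norm v _

theorem norm_sndPart_le {k l : ℕ} (v : Fin (k + l) → ℝ) : ‖sndPart v‖ ≤ ‖v‖ :=
  (pi_norm_le_iff_of_nonneg (norm_nonneg _)).2 fun _ => norm_le_pi_norm v _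

theorem norm_append_le {k l : ℕ} {a : Fin k → ℝ} {b : Fin l → ℝ} {c : ℝ} (hc : 0 ≤ c)
    (ha : ‖a‖ ≤ c) (hb : ‖b‖ ≤ c) : ‖Fin.append a b‖ ≤ c := by
  refine (pi_norm_le_iff_of_nonneg hc).2 fun i => ?_
  induction i using Fin.addCases with
  | left i => simpa using (norm_le_pi_norm a i).trans ha
  | right i => simpa using (norm_le_pi_norm b i).trans hb

theorem append_sub_append {k l : ℕ} (a a' : Fin k → ℝ) (b b' : Fin l → ℝ) :
    Fin.append a b - Fin.append a' b' = Fin.append (a - a') (b - b') := by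
  funext i
  induction i using Fin.addCases with
  | left i => simp
  | right i => simp

/-- The factor `(x, y) ↦ (x, y, b(x))`, whose last block lists the velocity components without
their values at the origin, scaled by `h ∑ j, ω j`. The scaling bounds the Lipschitz constant by
that of one time step of the full velocity field, however small the individual weights are; the
subtraction makes the values bounded by the Lipschitz constant. -/
def liftFactor (h : ℝ) (ω : Fin dy → ℝ) (f : Fin dy → (Fin m → ℝ) → Fin m → ℝ)
    (v : Fin (m + dy) → ℝ) : Fin (m + dy + dy * m) → ℝ :=
  Fin.append v fun r => h * (∑ j, ω j) *
    (f (finProdFinEquiv.symm r).1 (fstPart v) (finProdFinEquiv.symm r).2 -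
      f (finProdFinEquiv.symm r).1 0 (finProdFinEquiv.symm r).2)

/-- The multilinear factor which performs an Euler step, given the values computed by
`liftFactor`. If all weights vanish, then so do the quotients `ω j / ∑ j, ω j`, by the convention for
division by zero, and the step is the identity. -/
def mixFactor (h : ℝ) (ω : Fin dy → ℝ) (f : Fin dy → (Fin m → ℝ) → Fin m → ℝ) (τ : ℝ)
    (w : Fin (m + dy + dy * m) → ℝ) : Fin (m + dy) → ℝ :=
  Fin.append
    (fun i => fstPart (fstPart w) i + (∑ j, (τ * (ω j / ∑ j, ω j)) *
      (sndPart (fstPart w) j * sndPart w (finProdFinEquiv (j, i)))) +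
      ∑ j, (τ * h * ω j * f j 0 i) * sndPart (fstPart w) j)
    (sndPart (fstPart w))

/-- The representation of the composition of the Euler steps `k, ..., k + r - 1`. -/
def flowRep (h : ℝ) (ω : Fin dy → ℝ) (f : ℕ → Fin dy → (Fin m → ℝ) → Fin m → ℝ) (τ : ℕ → ℝ) :
    ℕ → ℕ → Rep (m + dy) m
  | _, 0 => .last (Matrix.of fun i j => if j = Fin.castAdd dy i then 1 else 0)
  | k, r + 1 => .comp (liftFactor h ω (f k))
      (.comp (mixFactor h ω (f k) (τ k)) (flowRep h ω f τ (k + 1) r))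

theorem mixFactor_liftFactor {h : ℝ} {ω : Fin dy → ℝ} (hω : ∀ j, 0 ≤ ω j)
    (f : Fin dy → (Fin m → ℝ) → Fin m → ℝ) (τ : ℝ) (v : Fin (m + dy) → ℝ) :
    mixFactor h ω f τ (liftFactor h ω f v) =
      Fin.append (eulerStep h ω f τ (sndPart v) (fstPart v)) (sndPart v) := by
  have hβ : ∀ j, ω j / (∑ j, ω j) * (∑ j, ω j) = ω j := by
    intro j
    by_cases hW : ∑ j, ω j = 0
    · have := (sum_eq_zero_iff_of_nonneg fun j _ => hω j).1 hW j (mem_univ j)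
      simp [this]
    · field_simp
  simp only [mixFactor, liftFactor, fstPart_append, sndPart_append]
  congr 1
  funext i
  simp only [Equiv.symm_apply_apply, eulerStep, velocity, Pi.add_apply, Pi.smul_apply,
    Finset.sum_apply, smul_eq_mul]
  generalize ∑ j, ω j = W at *
  rw [add_assoc, ← sum_add_distrib, mul_sum]
  congr 1
  refine sum_congr rfl fun j _ => ?_
  linear_combination (τ * h * sndPart v j * (f j (fstPart v) i - f j 0 i)) * hβ j

theorem eval_last_proj (v : Fin (m + dy) → ℝ) :
    (Matrix.of fun (i : Fin m) (j : Fin (m + dy)) =>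
      if j = Fin.castAdd dy i then (1 : ℝ) else 0).mulVec v = fstPart v := by
  funext i
  simp [Matrix.mulVec, dotProduct, fstPart]

theorem eval_flowRep {h : ℝ} {ω : Fin dy → ℝ} (hω : ∀ j, 0 ≤ ω j)
    (f : ℕ → Fin dy → (Fin m → ℝ) → Fin m → ℝ) (τ : ℕ → ℝ) (k r : ℕ) (v : Fin (m + dy) → ℝ) :
    (flowRep h ω f τ k r).eval v = euler h ω f τ (sndPart v) k r (fstPart v) := by
  induction r generalizing k v with
  | zero => exact eval_last_proj v
  | succ r ih =>
    change (flowRep h ω f τ (k + 1) r).eval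
      (mixFactor h ω (f k) (τ k) (liftFactor h ω (f k) v)) = _
    rw [mixFactor_liftFactor hω, ih, fstPart_append, sndPart_append]
    rfl

theorem numVars_liftFactor_le (h : ℝ) (ω : Fin dy → ℝ)
    (f : Fin dy → (Fin m → ℝ) → Fin m → ℝ) (r : Fin (dy * m)) :
    numVars (fun v => liftFactor h ω f v (Fin.natAdd _ r)) ≤ m := by
  refine (numVars_le_of_subset (s := Fin.castAdd dy '' (Set.univ : Set (Fin m))) ?_).trans
    ((Set.ncard_image_le (Set.toFinite _)).trans (by simp))
  intro k hk x c
  have : fstPart (Function.update x k c) = fstPart x := by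
    funext i
    exact Function.update_of_ne (fun h => hk ⟨i, trivial, h⟩) c x
  simp [liftFactor, this]

theorem sparsity_flowRep_le (hm : 1 ≤ m) (h : ℝ) (ω : Fin dy → ℝ)
    (f : ℕ → Fin dy → (Fin m → ℝ) → Fin m → ℝ) (τ : ℕ → ℝ) (k r : ℕ) :
    (flowRep h ω f τ k r).sparsity ≤ m := by
  induction r generalizing k with
  | zero => exact Nat.zero_le _
  | succ r ih =>
    refine max_le (factorSparsity_le hm fun i => ?_) (max_le ?_ (ih (k + 1)))
    · induction i using Fin.addCases with
      | left i =>
        simp only [liftFactor, Fin.append_left]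
        exact (numVars_coord_le i).trans hm
      | right r => exact numVars_liftFactor_le h ω (f k) r
    · refine (factorSparsity_le_of_isMultilin ?_).trans hm
      intro i x l
      change IsAffineInOne _
      induction i using Fin.addCases with
      | left i =>
        simp only [mixFactor, Fin.append_left, fstPart, sndPart]
        refine ((isAffineInOne_coord x l _).add (.sum _ fun j => .smul _ ?_)).add
          (.sum _ fun j => .smul _ (isAffineInOne_coord x l _))
        refine isAffineInOne_coord_mul_coord x l fun hne => ?_
        have := congrArg Fin.val hne
        simp at this
        omega
      | right j =>
        simp only [mixFactor, Fin.append_right, fstPart, sndPart]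
        exact isAffineInOne_coord x l _

theorem complexity_flowRep_le (hdy : 1 ≤ dy) (h : ℝ) (ω : Fin dy → ℝ)
    (f : ℕ → Fin dy → (Fin m → ℝ) → Fin m → ℝ) (τ : ℕ → ℝ) (k r : ℕ) :
    (flowRep h ω f τ k r).complexity ≤ (r + 1) * (5 * (m + 1) ^ 2 * dy) := by
  induction r generalizing k with
  | zero =>
    refine (sum_le_sum (g := fun _ => m + dy) fun i _ => numVars_le _).trans ?_
    simp
    nlinarith [Nat.zero_le (m * dy), Nat.mul_le_mul_left (m * m) hdy]
  | succ r ih =>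
    have h1 : ∑ i, numVars (fun v => liftFactor h ω (f k) v i) ≤ (m + dy) + dy * m * m := by
      rw [Fin.sum_univ_add]
      refine Nat.add_le_add ((sum_le_sum (g := fun _ => 1) fun i _ => ?_).trans (by simp))
        ((sum_le_sum (g := fun _ => m) fun r _ => numVars_liftFactor_le h ω (f k) r).trans
          (by simp))
      simp only [liftFactor, Fin.append_left]
      exact numVars_coord_le i
    have h2 : ∑ i, numVars (fun w => mixFactor h ω (f k) (τ k) w i) ≤
        m * (m + dy + dy * m) + dy := by
      rw [Fin.sum_univ_add]
      refine Nat.add_le_add ((sum_le_sum fun i _ => numVars_le _).trans (by simp))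
        ((sum_le_sum (g := fun _ => 1) fun j _ => ?_).trans (by simp))
      simp only [mixFactor, Fin.append_right]
      exact numVars_coord_le _
    have h3 := ih (k + 1)
    have h4 : (m + dy) + dy * m * m + (m * (m + dy + dy * m) + dy) ≤ 5 * (m + 1) ^ 2 * dy := by
      have := Nat.mul_le_mul_left m hdy
      have := Nat.mul_le_mul_left (m * m) hdy
      nlinarith
    change _ + (_ + _) ≤ _
    calc _ ≤ 5 * (m + 1) ^ 2 * dy + (r + 1) * (5 * (m + 1) ^ 2 * dy) := by omega
      _ = _ := by ring

/-- The regularizer of the representation of `r` Euler steps, on a set from which these steps do not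
leave the ball of radius `ρ`. -/
theorem reg_flowRep_le {h : ℝ} {ω : Fin dy → ℝ} {f : ℕ → Fin dy → (Fin m → ℝ) → Fin m → ℝ}
    {τ : ℕ → ℝ} {ρ A M B : ℝ} (hf : VelocityBounds ω f ρ A M) (hh : 0 ≤ h) (hA0 : 0 ≤ A)
    (hτ0 : ∀ k, 0 ≤ τ k) (hτ1 : ∀ k, τ k ≤ 1) (hρB : ρ ≤ B) (hMB : h * (∑ j, ω j) * M ≤ B)
    (hMρB : h * (∑ j, ω j) * (M * ρ) ≤ B) (r : ℕ) :
    ∀ (k : ℕ) {R : ℝ} {D : Set (Fin (m + dy) → ℝ)}, 0 ≤ R →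
      (∀ v ∈ D, ‖fstPart v‖ ≤ R ∧ ‖sndPart v‖ ≤ 1) → R + r * (h * A) ≤ ρ →
      (1 + h * (∑ j, ω j) * M) ^ r * (2 + r * (h * A)) ≤ B →
      (flowRep h ω f τ k r).reg D ≤ ENNReal.ofReal B := by
  have hW0 : 0 ≤ ∑ j, ω j := sum_nonneg fun j _ => hf.weight_nonneg j
  have hM := hf.lip_nonneg
  have hhA : 0 ≤ h * A := by positivity
  induction r with
  | zero =>
    intro k R D hR0 hD hR hB
    have hB1 : 1 ≤ B := by simp at hB; linarith
    refine max_le (by rw [ENNReal.one_le_ofReal]; exact hB1) ?_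
    have : (Matrix.of fun (i : Fin m) (j : Fin (m + dy)) =>
        if j = Fin.castAdd dy i then (1 : ℝ) else 0).mulVec = fstPart := by
      funext v; exact eval_last_proj v
    rw [this]
    refine lipNormOn_le (by linarith) (fun v hv => (hD v hv).1.trans ?_) fun v _ v' _ => ?_
    · simp at hR; linarith
    · exact (norm_fstPart_le (v - v')).trans (le_mul_of_one_le_left (norm_nonneg _) hB1)
  | succ r ih =>
    intro k R D hR0 hD hR hB
    push_cast at hR hB
    set E := 1 + h * (∑ j, ω j) * M with hE
    have hE1 : 1 ≤ E := by
      have : 0 ≤ h * (∑ j, ω j) * M := by positivity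
      linarith
    have hr : 0 ≤ (r : ℝ) * (h * A) := by positivity
    have hRρ : R ≤ ρ := by linarith
    have hEr : 1 ≤ E ^ r := one_le_pow₀ hE1
    have hB' : E ^ r * (2 + (r + 1) * (h * A)) ≤ B := by
      refine le_trans ?_ hB
      rw [pow_succ]
      exact mul_le_mul_of_nonneg_right (le_mul_of_one_le_right (by linarith) hE1) (by positivity)
    have hB2 : 2 + (r + 1) * (h * A) ≤ B :=
      (le_mul_of_one_le_left (by positivity) hEr).trans hB'
    have hB1 : 1 ≤ B := by nlinarith
    have hB0 : 0 ≤ B := by linarith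
    have hstep : ∀ v ∈ D,
        ‖eulerStep h ω (f k) (τ k) (sndPart v) (fstPart v)‖ ≤ R + h * A := by
      intro v hv
      obtain ⟨h1, h2⟩ := hD v hv
      exact (norm_eulerStep_le hh h2 hA0 (hf.bound k _ (h1.trans hRρ)) (hτ0 k) (hτ1 k)).trans
        (by linarith)
    have hv_le : ∀ v v', ‖v - v'‖ ≤ ‖liftFactor h ω (f k) v - liftFactor h ω (f k) v'‖ := by
      intro v v'
      have h1 := norm_fstPart_le (liftFactor h ω (f k) v - liftFactor h ω (f k) v')
      have h2 : fstPart (liftFactor h ω (f k) v - liftFactor h ω (f k) v') = v - v' := by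
        change fstPart (liftFactor h ω (f k) v) - fstPart (liftFactor h ω (f k) v') = _
        simp [liftFactor]
      rwa [h2] at h1
    -- The Euler step as a function of the output of `liftFactor`.
    have hmix : ∀ v ∈ D, ∀ v' ∈ D,
        ‖eulerStep h ω (f k) (τ k) (sndPart v) (fstPart v) -
          eulerStep h ω (f k) (τ k) (sndPart v') (fstPart v')‖ ≤
        (2 + h * A) * ‖liftFactor h ω (f k) v - liftFactor h ω (f k) v'‖ := by
      intro v hv v' hv'
      obtain ⟨h1, h2⟩ := hD v hv
      obtain ⟨h1', h2'⟩ := hD v' hv'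
      have h4 := hv_le v v'
      have h5 := norm_eulerStep_sub_le (y' := sndPart v') hh hf.weight_nonneg h2
        (hf.bound k _ (h1'.trans hRρ)) (u := fstPart v) (norm_nonneg
          (liftFactor h ω (f k) v - liftFactor h ω (f k) v')) (fun j => ?_) (hτ0 k) (hτ1 k)
      · have h6 : ‖fstPart v - fstPart v'‖ ≤ ‖v - v'‖ := norm_fstPart_le (v - v')
        have h7 : h * A * ‖sndPart v - sndPart v'‖ ≤ h * A * ‖v - v'‖ :=
          mul_le_mul_of_nonneg_left (norm_sndPart_le (v - v')) hhA
        have h8 := mul_le_mul_of_nonneg_left h4 hhA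
        linarith
      · rw [← abs_of_nonneg (mul_nonneg hh hW0), ← Real.norm_eq_abs, ← norm_smul]
        refine (pi_norm_le_iff_of_nonneg (norm_nonneg _)).2 fun i => ?_
        refine le_trans (le_of_eq ?_) (norm_le_pi_norm
          (liftFactor h ω (f k) v - liftFactor h ω (f k) v') (Fin.natAdd _ (finProdFinEquiv (j, i))))
        simp only [liftFactor, Pi.sub_apply, Fin.append_right, Equiv.symm_apply_apply,
          Pi.smul_apply, smul_eq_mul]
        congr 1
        ring
    have hlift : ∀ v ∈ D, ∀ v' ∈ D, ∀ j i, ‖h * (∑ j, ω j) * (f k j (fstPart v) i -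
        f k j (fstPart v') i)‖ ≤ h * (∑ j, ω j) * (M * ‖fstPart v - fstPart v'‖) := by
      intro v hv v' hv' j i
      rw [norm_mul, Real.norm_eq_abs, abs_of_nonneg (mul_nonneg hh hW0)]
      refine mul_le_mul_of_nonneg_left ?_ (mul_nonneg hh hW0)
      exact (norm_le_pi_norm (f k j (fstPart v) - f k j (fstPart v')) i).trans
        (hf.lip k j _ _ ((hD v hv).1.trans hRρ) ((hD v' hv').1.trans hRρ))
    refine max_le (max_le (lipNormOn_le hB0 ?_ ?_) (lipSemiOn_le hB0 ?_)) (max_le (max_le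
      (lipNormOn_le hB0 ?_ ?_) (lipSemiOn_le hB0 ?_)) (ih (k + 1) (R := R + h * A) (by positivity)
        ?_ (by linarith) ?_))
    · intro v hv
      obtain ⟨h1, h2⟩ := hD v hv
      refine norm_append_le hB0 ?_ ?_
      · refine (pi_norm_le_iff_of_nonneg hB0).2 fun i => ?_
        induction i using Fin.addCases with
        | left i => exact (norm_le_pi_norm (fstPart v) i).trans (h1.trans (hRρ.trans hρB))
        | right j => exact (norm_le_pi_norm (sndPart v) j).trans (h2.trans hB1)
      · refine (pi_norm_le_iff_of_nonneg hB0).2 fun r => ?_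
        rw [norm_mul, Real.norm_eq_abs, abs_of_nonneg (mul_nonneg hh hW0)]
        refine le_trans (mul_le_mul_of_nonneg_left ?_ (mul_nonneg hh hW0)) hMρB
        refine (norm_le_pi_norm (f k (finProdFinEquiv.symm r).1 (fstPart v) -
          f k (finProdFinEquiv.symm r).1 0) _).trans ((hf.lip k _ _ _ (h1.trans hRρ)
            (by rw [norm_zero]; linarith)).trans ?_)
        rw [sub_zero]
        exact mul_le_mul_of_nonneg_left (h1.trans hRρ) hM
    · intro v hv v' hv'
      rw [liftFactor, liftFactor, append_sub_append]
      refine norm_append_le (by positivity) (le_mul_of_one_le_left (norm_nonneg _) hB1) ?_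
      refine (pi_norm_le_iff_of_nonneg (by positivity)).2 fun r => ?_
      rw [Pi.sub_apply, ← mul_sub, sub_sub_sub_cancel_right]
      refine (hlift v hv v' hv' _ _).trans ?_
      rw [← mul_assoc]
      exact mul_le_mul hMB (norm_fstPart_le (v - v')) (norm_nonneg _) hB0
    · intro v hv v' hv'
      change ‖(flowRep h ω f τ k (r + 1)).eval v - (flowRep h ω f τ k (r + 1)).eval v'‖ ≤ _
      rw [eval_flowRep hf.weight_nonneg, eval_flowRep hf.weight_nonneg]
      refine (hf.norm_euler_sub_le hh hA0 hτ0 hτ1 (hD v hv).2 (hD v' hv').2 (r + 1) k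
        (hD v hv).1 (hD v' hv').1 (by push_cast; linarith)).trans ?_
      have h1 : ‖fstPart v - fstPart v'‖ ≤ ‖v - v'‖ := norm_fstPart_le (v - v')
      have h2 : ‖sndPart v - sndPart v'‖ ≤ ‖v - v'‖ := norm_sndPart_le (v - v')
      calc _ ≤ E ^ (r + 1) * (‖v - v'‖ + (r + 1) * (h * A) * ‖v - v'‖) := by
            push_cast; gcongr
        _ ≤ E ^ (r + 1) * (2 + (r + 1) * (h * A)) * ‖v - v'‖ := by
            rw [mul_assoc (E ^ (r + 1))]
            refine mul_le_mul_of_nonneg_left ?_ (by positivity)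
            linarith [norm_nonneg (v - v')]
        _ ≤ B * ‖v - v'‖ := mul_le_mul_of_nonneg_right hB (norm_nonneg _)
    · rintro _ ⟨v, hv, rfl⟩
      rw [mixFactor_liftFactor hf.weight_nonneg]
      exact norm_append_le hB0 ((hstep v hv).trans (by linarith)) ((hD v hv).2.trans hB1)
    · rintro _ ⟨v, hv, rfl⟩ _ ⟨v', hv', rfl⟩
      rw [mixFactor_liftFactor hf.weight_nonneg, mixFactor_liftFactor hf.weight_nonneg,
        append_sub_append]
      refine norm_append_le (by positivity) ((hmix v hv v' hv').trans
        (mul_le_mul_of_nonneg_right (by linarith) (norm_nonneg _))) ?_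
      refine le_trans ?_ (le_mul_of_one_le_left (norm_nonneg _) hB1)
      exact (norm_sndPart_le (v - v')).trans (hv_le v v')
    · rintro _ ⟨v, hv, rfl⟩ _ ⟨v', hv', rfl⟩
      rw [mixFactor_liftFactor hf.weight_nonneg, mixFactor_liftFactor hf.weight_nonneg,
        eval_flowRep hf.weight_nonneg, eval_flowRep hf.weight_nonneg]
      simp only [fstPart_append, sndPart_append]
      refine (hf.norm_euler_sub_le hh hA0 hτ0 hτ1 (hD v hv).2 (hD v' hv').2 r (k + 1)
        (hstep v hv) (hstep v' hv') (by linarith)).trans ?_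
      have h2 : ‖sndPart v - sndPart v'‖ ≤ ‖liftFactor h ω (f k) v - liftFactor h ω (f k) v'‖ :=
        (norm_sndPart_le (v - v')).trans (hv_le v v')
      refine le_trans ?_ (mul_le_mul_of_nonneg_right hB' (norm_nonneg _))
      rw [mul_assoc (E ^ r)]
      refine mul_le_mul_of_nonneg_left ?_ (by positivity)
      have h3 := hmix v hv v' hv'
      have h4 := mul_le_mul_of_nonneg_left h2 hr
      linarith
    · rintro _ ⟨_, ⟨v, hv, rfl⟩, rfl⟩
      rw [mixFactor_liftFactor hf.weight_nonneg, fstPart_append, sndPart_append]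
      exact ⟨hstep v hv, (hD v hv).2⟩
    · refine le_trans ?_ hB'
      gcongr
      linarith

end FlowRep

open MeasureTheory

/-! ### The time-discretized flow as a function of time -/

section EulerTime

variable {m dy : ℕ} {h : ℝ} {ω : Fin dy → ℝ} {f : ℕ → Fin dy → (Fin m → ℝ) → Fin m → ℝ}
  {ρ A M : ℝ}

theorem euler_congr {τ τ' : ℕ → ℝ} (y : Fin dy → ℝ) (u : Fin m → ℝ) (r : ℕ)
    (hτ : ∀ k < r, τ k = τ' k) : euler h ω f τ y 0 r u = euler h ω f τ' y 0 r u := by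
  induction r with
  | zero => rfl
  | succ r ih =>
    rw [euler_succ, euler_succ, zero_add, hτ r (Nat.lt_succ_self r),
      ih fun k hk => hτ k (hk.trans (Nat.lt_succ_self r))]

theorem VelocityBounds.norm_euler_le (hf : VelocityBounds ω f ρ A M) (hh : 0 ≤ h) (hA0 : 0 ≤ A)
    {τ : ℕ → ℝ} (hτ0 : ∀ k, 0 ≤ τ k) (hτ1 : ∀ k, τ k ≤ 1) {y : Fin dy → ℝ} (hy : ‖y‖ ≤ 1)
    {R : ℝ} {u : Fin m → ℝ} (hu : ‖u‖ ≤ R) (r : ℕ) (hr : R + r * (h * A) ≤ ρ) :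
    ‖euler h ω f τ y 0 r u‖ ≤ R + r * (h * A) := by
  induction r with
  | zero => simpa [euler] using hu
  | succ r ih =>
    have hhA : 0 ≤ h * A := by positivity
    push_cast at hr
    have h1 := ih (by linarith)
    rw [euler_succ, zero_add]
    refine (norm_eulerStep_le hh hy hA0 (hf.bound r _ (h1.trans (by linarith))) (hτ0 r)
      (hτ1 r)).trans ?_
    push_cast
    linarith

/-- If each step is carried out only when all previous ones are complete, then the velocities may be
evaluated at the complete steps. -/
theorem euler_eq_add_sum {τ : ℕ → ℝ} (hτ : ∀ k r, k < r → τ r ≠ 0 → τ k = 1) (y : Fin dy → ℝ)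
    (u : Fin m → ℝ) (r : ℕ) :
    euler h ω f τ y 0 r u = u + ∑ k ∈ range r,
      (τ k * h) • velocity ω (f k) y (euler h ω f (fun _ => 1) y 0 k u) := by
  induction r with
  | zero => simp [euler]
  | succ r ih =>
    rw [euler_succ, sum_range_succ, ← add_assoc, ← ih, zero_add, eulerStep]
    by_cases h0 : τ r = 0
    · simp [h0]
    · rw [euler_congr (τ' := fun _ => 1) y u r fun k hk => hτ k r hk h0]

theorem ramp_clock (s : ℝ) (k r : ℕ) (hkr : k < r) (h : ramp (s - r) ≠ 0) : ramp (s - k) = 1 := by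
  have h1 : 0 < s - r := by
    by_contra! h1
    exact h (ramp_of_nonpos h1)
  have h2 : (k : ℝ) + 1 ≤ r := by exact_mod_cast hkr
  exact ramp_of_one_le (by linarith)

theorem VelocityBounds.norm_euler_ramp_sub_le (hf : VelocityBounds ω f ρ A M) (hh : 0 < h)
    (hA0 : 0 ≤ A) {y : Fin dy → ℝ} (hy : ‖y‖ ≤ 1) {R : ℝ} {u : Fin m → ℝ} (hu : ‖u‖ ≤ R)
    (n : ℕ) (hn : R + n * (h * A) ≤ ρ) (t t' : ℝ) :
    ‖euler h ω f (fun k => ramp (h⁻¹ * t - k)) y 0 n u -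
      euler h ω f (fun k => ramp (h⁻¹ * t' - k)) y 0 n u‖ ≤ A * |t - t'| := by
  rw [euler_eq_add_sum (ramp_clock _), euler_eq_add_sum (ramp_clock _), add_sub_add_left_eq_sub,
    ← sum_sub_distrib]
  calc _ ≤ ∑ k ∈ range n, |ramp (h⁻¹ * t - k) - ramp (h⁻¹ * t' - k)| * (h * A) := by
        refine norm_sum_le_of_le _ fun k hk => ?_
        have hk' : (k : ℝ) * (h * A) ≤ n * (h * A) := by
          have : (k : ℝ) ≤ n := by exact_mod_cast (mem_range.1 hk).le
          gcongr
        have h1 := hf.norm_euler_le hh.le hA0 (τ := fun _ => 1) (fun _ => zero_le_one)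
          (fun _ => le_rfl) hy hu k (by linarith)
        rw [← sub_smul, ← sub_mul, norm_smul, norm_mul, Real.norm_eq_abs, Real.norm_eq_abs,
          abs_of_pos hh, mul_assoc]
        refine mul_le_mul_of_nonneg_left (mul_le_mul_of_nonneg_left ?_ hh.le) (abs_nonneg _)
        exact (norm_velocity_le (hf.bound k _ (h1.trans (by linarith)))).trans
          (mul_le_of_le_one_right hA0 hy)
    _ ≤ |h⁻¹ * t - h⁻¹ * t'| * (h * A) := by
        rw [← sum_mul]
        exact mul_le_mul_of_nonneg_right (sum_abs_ramp_sub _ _ _) (by positivity)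
    _ = A * |t - t'| := by
        rw [← mul_sub, abs_mul, abs_of_pos (inv_pos.2 hh)]
        field_simp

theorem euler_ramp_node (hh : 0 < h) (y : Fin dy → ℝ) (u : Fin m → ℝ) {k n : ℕ} (hk : k ≤ n) :
    euler h ω f (fun i => ramp (h⁻¹ * (k * h) - i)) y 0 n u =
      euler h ω f (fun _ => 1) y 0 k u := by
  have hs : h⁻¹ * (k * h) = k := by field_simp
  induction n, hk using Nat.le_induction with
  | base =>
    refine euler_congr y u k fun i hi => ?_
    have : (i : ℝ) + 1 ≤ k := by exact_mod_cast hi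
    exact ramp_of_one_le (by rw [hs]; linarith)
  | succ n hn ih =>
    have : (k : ℝ) ≤ n := by exact_mod_cast hn
    rw [euler_succ, ih, eulerStep, zero_add, ramp_of_nonpos (by rw [hs]; linarith)]
    simp

end EulerTime

/-! ### Averages in time and the discretization error -/

section Error

variable {m dy : ℕ}

/-- A family of velocity components which are measurable in time and satisfy uniform bounds. -/
structure IsVelocityFamily (ω : Fin dy → ℝ) (a : Fin dy → ℝ → (Fin m → ℝ) → Fin m → ℝ)
    (A A₀ Λ : ℝ) : Prop where
  weight_nonneg : ∀ j, 0 ≤ ω j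
  lip_nonneg : 0 ≤ Λ
  measurable : ∀ j x, Measurable fun t => a j t x
  bound : ∀ j t x, ‖a j t x‖ ≤ A₀
  lip : ∀ j t x x', ‖a j t x - a j t x'‖ ≤ Λ * ‖x - x'‖
  sum_bound : ∀ t x, ∑ j, ‖ω j • a j t x‖ ≤ A

/-- The averages of the velocity components over the time intervals `[k h, (k + 1) h]`. -/
def timeAverage (a : Fin dy → ℝ → (Fin m → ℝ) → Fin m → ℝ) (h : ℝ) (k : ℕ) (j : Fin dy)
    (x : Fin m → ℝ) : Fin m → ℝ :=
  h⁻¹ • ∫ s in (k * h)..((k + 1) * h), a j s x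

theorem norm_velocity_sub_velocity_le {ω : Fin dy → ℝ} (hω : ∀ j, 0 ≤ ω j)
    {f f' : Fin dy → (Fin m → ℝ) → Fin m → ℝ} {y : Fin dy → ℝ} (hy : ‖y‖ ≤ 1)
    {u u' : Fin m → ℝ} {δ : ℝ} (hδ : ∀ j, ‖f j u - f' j u'‖ ≤ δ) :
    ‖velocity ω f y u - velocity ω f' y u'‖ ≤ (∑ j, ω j) * δ := by
  rw [velocity, velocity, ← sum_sub_distrib, sum_mul]
  refine norm_sum_le_of_le _ fun j _ => ?_
  rw [← smul_sub, norm_smul, norm_mul, Real.norm_eq_abs (ω j), abs_of_nonneg (hω j)]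
  exact mul_le_mul (mul_le_of_le_one_left (hω j) ((norm_le_pi_norm y j).trans hy)) (hδ j)
    (norm_nonneg _) (hω j)

namespace IsVelocityFamily

variable {ω : Fin dy → ℝ} {a : Fin dy → ℝ → (Fin m → ℝ) → Fin m → ℝ} {A A₀ Λ : ℝ}

theorem intervalIntegrable_comp (ha : IsVelocityFamily ω a A A₀ Λ) (j : Fin dy) {s t : ℝ}
    {γ : ℝ → Fin m → ℝ} (hγ : ContinuousOn γ (Set.uIcc s t)) :
    IntervalIntegrable (fun r => a j r (γ r)) volume s t := by
  have hcont : ∀ r, Continuous (a j r) := fun r =>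
    (LipschitzWith.of_dist_le_mul (K := Λ.toNNReal) fun x x' => by
      rw [dist_eq_norm, dist_eq_norm, Real.coe_toNNReal _ ha.lip_nonneg]
      exact ha.lip j r x x').continuous
  have hmeas : Measurable (Function.uncurry fun (x : Fin m → ℝ) r => a j r x) :=
    measurable_uncurry_of_continuous_of_measurable hcont (ha.measurable j)
  have hγm : AEMeasurable γ (volume.restrict (Set.uIoc s t)) :=
    (hγ.mono Set.uIoc_subset_uIcc).aemeasurable measurableSet_uIoc
  rw [intervalIntegrable_iff]
  exact IntegrableOn.of_bound (by rw [Set.uIoc, Real.volume_Ioc]; exact ENNReal.ofReal_lt_top)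
    (hmeas.comp_aemeasurable (hγm.prodMk aemeasurable_id)).aestronglyMeasurable A₀
    (Filter.Eventually.of_forall fun r => ha.bound j r (γ r))

theorem intervalIntegrable (ha : IsVelocityFamily ω a A A₀ Λ) (j : Fin dy) (s t : ℝ)
    (x : Fin m → ℝ) : IntervalIntegrable (fun r => a j r x) volume s t :=
  ha.intervalIntegrable_comp j (γ := fun _ => x) continuousOn_const

theorem intervalIntegrable_velocity (ha : IsVelocityFamily ω a A A₀ Λ) (y : Fin dy → ℝ) {s t : ℝ}
    {γ : ℝ → Fin m → ℝ} (hγ : ContinuousOn γ (Set.uIcc s t)) :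
    IntervalIntegrable (fun r => velocity ω (fun j => a j r) y (γ r)) volume s t := by
  have h := IntervalIntegrable.sum univ (f := fun j r => (y j * ω j) • a j r (γ r)) fun j _ =>
    (ha.intervalIntegrable_comp j hγ).smul (y j * ω j)
  simp only [velocity]
  simpa only [Finset.sum_fn] using h

theorem norm_timeAverage_sub_le (ha : IsVelocityFamily ω a A A₀ Λ) {h : ℝ} (hh : 0 < h) (k : ℕ)
    (j : Fin dy) (x x' : Fin m → ℝ) :
    ‖timeAverage a h k j x - timeAverage a h k j x'‖ ≤ Λ * ‖x - x'‖ := by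
  rw [timeAverage, timeAverage, ← smul_sub,
    ← intervalIntegral.integral_sub (ha.intervalIntegrable j _ _ x)
      (ha.intervalIntegrable j _ _ x'), norm_smul, Real.norm_eq_abs, abs_of_pos (inv_pos.2 hh)]
  have h1 := intervalIntegral.norm_integral_le_of_norm_le_const (a := k * h) (b := (k + 1) * h)
    (f := fun s => a j s x - a j s x') (C := Λ * ‖x - x'‖) fun s _ => ha.lip j s x x'
  rw [show (k + 1) * h - k * h = h by ring, abs_of_pos hh] at h1
  calc _ ≤ h⁻¹ * (Λ * ‖x - x'‖ * h) := mul_le_mul_of_nonneg_left h1 (inv_pos.2 hh).le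
    _ = _ := by field_simp

theorem sum_norm_timeAverage_le (ha : IsVelocityFamily ω a A A₀ Λ) {h : ℝ} (hh : 0 < h) (k : ℕ)
    (x : Fin m → ℝ) : ∑ j, ‖ω j • timeAverage a h k j x‖ ≤ A := by
  have hkh : (k : ℝ) * h ≤ (k + 1) * h := by nlinarith
  have hint : ∀ j, IntervalIntegrable (fun s => ‖ω j • a j s x‖) volume (k * h) ((k + 1) * h) :=
    fun j => ((ha.intervalIntegrable j _ _ x).smul (ω j)).norm
  calc _ ≤ ∑ j, h⁻¹ * ∫ s in (k * h)..((k + 1) * h), ‖ω j • a j s x‖ := by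
        refine sum_le_sum fun j _ => ?_
        rw [timeAverage, smul_comm, ← intervalIntegral.integral_smul, norm_smul, Real.norm_eq_abs,
          abs_of_pos (inv_pos.2 hh)]
        exact mul_le_mul_of_nonneg_left (intervalIntegral.norm_integral_le_integral_norm hkh)
          (inv_pos.2 hh).le
    _ = h⁻¹ * ∫ s in (k * h)..((k + 1) * h), ∑ j, ‖ω j • a j s x‖ := by
        rw [intervalIntegral.integral_finsetSum fun j _ => hint j, mul_sum]
    _ ≤ h⁻¹ * ∫ _s in (k * h)..((k + 1) * h), A :=
        mul_le_mul_of_nonneg_left (intervalIntegral.integral_mono_on hkh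
          (by simpa only [Finset.sum_fn] using IntervalIntegrable.sum univ fun j _ => hint j)
          intervalIntegrable_const
          fun s _ => ha.sum_bound s x) (inv_pos.2 hh).le
    _ = A := by
        rw [intervalIntegral.integral_const, smul_eq_mul]
        field_simp
        ring

theorem integral_velocity (ha : IsVelocityFamily ω a A A₀ Λ) {h : ℝ} (hh : 0 < h) (k : ℕ)
    (y : Fin dy → ℝ) (x : Fin m → ℝ) :
    ∫ s in (k * h)..((k + 1) * h), velocity ω (fun j => a j s) y x =
      h • velocity ω (timeAverage a h k) y x := by
  simp only [velocity, timeAverage]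
  have hint : ∀ j, IntervalIntegrable (fun s => (y j * ω j) • a j s x) volume (k * h)
      ((k + 1) * h) := fun j => (ha.intervalIntegrable j _ _ x).smul (y j * ω j)
  rw [intervalIntegral.integral_finsetSum fun j _ => hint j, smul_sum]
  refine sum_congr rfl fun j _ => ?_
  rw [intervalIntegral.integral_smul, smul_comm h, smul_smul h, mul_inv_cancel₀ hh.ne', one_smul]

variable {T : ℝ} {γ : ℝ → Fin m → ℝ} {x : Fin m → ℝ} {y : Fin dy → ℝ}

theorem sub_eq_integral (ha : IsVelocityFamily ω a A A₀ Λ) (hγ : ContinuousOn γ (Set.Icc 0 T))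
    (hint : ∀ t ∈ Set.Icc 0 T, γ t = x + ∫ s in (0 : ℝ)..t, velocity ω (fun j => a j s) y (γ s))
    {s t : ℝ} (hs : s ∈ Set.Icc 0 T) (ht : t ∈ Set.Icc 0 T) :
    γ t - γ s = ∫ r in s..t, velocity ω (fun j => a j r) y (γ r) := by
  have h0 : (0 : ℝ) ∈ Set.Icc 0 T := ⟨le_rfl, hs.1.trans hs.2⟩
  have hI : ∀ r ∈ Set.Icc 0 T, IntervalIntegrable
      (fun r => velocity ω (fun j => a j r) y (γ r)) volume 0 r := fun r hr =>
    ha.intervalIntegrable_velocity y (hγ.mono (Set.uIcc_subset_Icc h0 hr))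
  rw [hint t ht, hint s hs, add_sub_add_left_eq_sub,
    intervalIntegral.integral_interval_sub_left (hI t ht) (hI s hs)]

theorem norm_curve_sub_le (ha : IsVelocityFamily ω a A A₀ Λ) (hγ : ContinuousOn γ (Set.Icc 0 T))
    (hint : ∀ t ∈ Set.Icc 0 T, γ t = x + ∫ s in (0 : ℝ)..t, velocity ω (fun j => a j s) y (γ s))
    (hy : ‖y‖ ≤ 1) {s t : ℝ} (hs : s ∈ Set.Icc 0 T) (ht : t ∈ Set.Icc 0 T) :
    ‖γ t - γ s‖ ≤ A * |t - s| := by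
  rw [ha.sub_eq_integral hγ hint hs ht]
  refine intervalIntegral.norm_integral_le_of_norm_le_const fun r _ => ?_
  refine (norm_velocity_le (ha.sum_bound r (γ r))).trans (mul_le_of_le_one_right ?_ hy)
  exact (sum_nonneg fun j _ => norm_nonneg _).trans (ha.sum_bound 0 0)

/-- The error of one Euler step: the time average of the velocity field has an error controlled by
the distance travelled in the step, and the interpolation contributes `η`. -/
theorem norm_curve_sub_eulerStep_le (ha : IsVelocityFamily ω a A A₀ Λ)
    (hγ : ContinuousOn γ (Set.Icc 0 T))
    (hint : ∀ t ∈ Set.Icc 0 T, γ t = x + ∫ s in (0 : ℝ)..t, velocity ω (fun j => a j s) y (γ s))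
    (hy : ‖y‖ ≤ 1) {h : ℝ} (hh : 0 < h) {k : ℕ} (hk : (k + 1) * h ≤ T)
    {f : Fin dy → (Fin m → ℝ) → Fin m → ℝ} {u : Fin m → ℝ} {η : ℝ}
    (hf : ∀ j, ‖timeAverage a h k j u - f j u‖ ≤ Λ * η) :
    ‖γ ((k + 1) * h) - eulerStep h ω f 1 y u‖ + (A * h + η) ≤
      (1 + h * (∑ j, ω j) * Λ) * (‖γ (k * h) - u‖ + (A * h + η)) := by
  have hA0 : 0 ≤ A := (sum_nonneg fun j _ => norm_nonneg _).trans (ha.sum_bound 0 0)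
  have hW0 : 0 ≤ ∑ j, ω j := sum_nonneg fun j _ => ha.weight_nonneg j
  have hkh : (k : ℝ) * h ≤ (k + 1) * h := by nlinarith
  have hk0 : (k : ℝ) * h ∈ Set.Icc 0 T := ⟨by positivity, hkh.trans hk⟩
  have hk1 : ((k : ℝ) + 1) * h ∈ Set.Icc 0 T := ⟨by positivity, hk⟩
  have hsub : Set.uIcc ((k : ℝ) * h) ((k + 1) * h) ⊆ Set.Icc 0 T := Set.uIcc_subset_Icc hk0 hk1
  have key : γ ((k + 1) * h) - eulerStep h ω f 1 y u = (γ (k * h) - u) +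
      (∫ s in (k * h)..((k + 1) * h),
        (velocity ω (fun j => a j s) y (γ s) - velocity ω (fun j => a j s) y u)) +
      h • (velocity ω (timeAverage a h k) y u - velocity ω f y u) := by
    rw [intervalIntegral.integral_sub (ha.intervalIntegrable_velocity y (hγ.mono hsub))
      (ha.intervalIntegrable_velocity y (γ := fun _ => u) continuousOn_const),
      ha.integral_velocity hh, ← ha.sub_eq_integral hγ hint hk0 hk1, eulerStep, smul_sub, one_mul]
    abel
  have h1 : ‖∫ s in (k * h)..((k + 1) * h),
      (velocity ω (fun j => a j s) y (γ s) - velocity ω (fun j => a j s) y u)‖ ≤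
      (∑ j, ω j) * (Λ * (‖γ (k * h) - u‖ + A * h)) * h := by
    have := intervalIntegral.norm_integral_le_of_norm_le_const (a := k * h) (b := (k + 1) * h)
      (f := fun s => velocity ω (fun j => a j s) y (γ s) - velocity ω (fun j => a j s) y u)
      (C := (∑ j, ω j) * (Λ * (‖γ (k * h) - u‖ + A * h))) fun s hs => ?_
    · rwa [show ((k : ℝ) + 1) * h - k * h = h by ring, abs_of_pos hh] at this
    · rw [Set.uIoc_of_le hkh] at hs
      refine norm_velocity_sub_velocity_le ha.weight_nonneg hy fun j => (ha.lip j s _ _).trans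
        (mul_le_mul_of_nonneg_left ?_ ha.lip_nonneg)
      have hs' : s ∈ Set.Icc 0 T := ⟨hk0.1.trans hs.1.le, hs.2.trans hk⟩
      have h2 := ha.norm_curve_sub_le hγ hint hy hk0 hs'
      have h3 := norm_sub_le_norm_sub_add_norm_sub (γ s) (γ (k * h)) u
      have h4 : A * |s - k * h| ≤ A * h := by
        refine mul_le_mul_of_nonneg_left ?_ hA0
        rw [abs_of_nonneg (by linarith [hs.1])]
        linarith [hs.2]
      linarith
  have h2 : ‖h • (velocity ω (timeAverage a h k) y u - velocity ω f y u)‖ ≤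
      h * ((∑ j, ω j) * (Λ * η)) := by
    rw [norm_smul, Real.norm_eq_abs, abs_of_pos hh]
    exact mul_le_mul_of_nonneg_left (norm_velocity_sub_velocity_le ha.weight_nonneg hy hf) hh.le
  have h3 := norm_add₃_le (a := γ (k * h) - u) (b := ∫ s in (k * h)..((k + 1) * h),
        (velocity ω (fun j => a j s) y (γ s) - velocity ω (fun j => a j s) y u))
      (c := h • (velocity ω (timeAverage a h k) y u - velocity ω f y u))
  rw [key]
  linarith

end IsVelocityFamily

end Error

/-! ### Networks for the characteristics -/

section Core

variable {m dy : ℕ} {ω : Fin dy → ℝ} {a : Fin dy → ℝ → (Fin m → ℝ) → Fin m → ℝ} {A A₀ Λ : ℝ}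

theorem one_add_pow_le_exp {p q : ℝ} (hp : 0 ≤ p) {k : ℕ} (h : k * p ≤ q) :
    (1 + p) ^ k ≤ Real.exp q := by
  calc (1 + p) ^ k ≤ Real.exp p ^ k :=
        pow_le_pow_left₀ (by positivity) (by rw [add_comm]; exact Real.add_one_le_exp p) k
    _ = Real.exp (k * p) := (Real.exp_nat_mul p k).symm
    _ ≤ Real.exp q := Real.exp_le_exp.2 h

namespace IsVelocityFamily

theorem nonneg_of_sum_bound (ha : IsVelocityFamily ω a A A₀ Λ) : 0 ≤ A :=
  (sum_nonneg fun _ _ => norm_nonneg _).trans (ha.sum_bound 0 0)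

theorem velocityBounds (ha : IsVelocityFamily ω a A A₀ Λ) (hm : 1 ≤ m) {h : ℝ} (hh : 0 < h)
    {ρ : ℝ} (hρ : 0 < ρ) {K : ℕ} (hK : 1 ≤ K) :
    VelocityBounds ω (fun k j => gridInterp ρ K (timeAverage a h k j)) ρ A (4 * m * Λ) where
  weight_nonneg := ha.weight_nonneg
  lip_nonneg := mul_nonneg (by positivity) ha.lip_nonneg
  bound k _ hu := sum_norm_smul_gridInterp_le hρ hK ω _ (ha.sum_norm_timeAverage_le hh k) hu
  lip k j _ _ hu hu' := norm_gridInterp_sub_gridInterp_le hm hρ hK ha.lip_nonneg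
    (ha.norm_timeAverage_sub_le hh k j) hu hu'

variable {T : ℝ} {γ : ℝ → Fin m → ℝ} {x : Fin m → ℝ} {y : Fin dy → ℝ}

/-- The discretization error at the nodes of the time grid. -/
theorem norm_curve_sub_euler_node_le (ha : IsVelocityFamily ω a A A₀ Λ) (hm : 1 ≤ m)
    (hγ : ContinuousOn γ (Set.Icc 0 T))
    (hint : ∀ t ∈ Set.Icc 0 T, γ t = x + ∫ s in (0 : ℝ)..t, velocity ω (fun j => a j s) y (γ s))
    (hy : ‖y‖ ≤ 1) {h ρ R : ℝ} (hh : 0 < h) (hρ : 0 < ρ) (hx : ‖x‖ ≤ R) {K : ℕ} (hK : 1 ≤ K)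
    (k : ℕ) (hkT : k * h ≤ T) (hkρ : R + k * (h * A) ≤ ρ) :
    ‖γ (k * h) - euler h ω (fun k j => gridInterp ρ K (timeAverage a h k j)) (fun _ => 1) y 0 k x‖ +
      (A * h + (gridDensity ρ K)⁻¹) ≤
      (1 + h * (∑ j, ω j) * Λ) ^ k * (A * h + (gridDensity ρ K)⁻¹) := by
  have hA0 := ha.nonneg_of_sum_bound
  have hW0 : 0 ≤ ∑ j, ω j := sum_nonneg fun j _ => ha.weight_nonneg j
  have hhA : 0 ≤ h * A := by positivity
  induction k with
  | zero =>
    have : γ 0 = x := by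
      rw [hint 0 ⟨le_rfl, by simpa using hkT⟩, intervalIntegral.integral_same, add_zero]
    simp [euler, this]
  | succ k ih =>
    push_cast at hkT hkρ ⊢
    have hρk : R + k * (h * A) ≤ ρ := by linarith
    have h1 := (ha.velocityBounds hm hh hρ hK).norm_euler_le hh.le hA0 (τ := fun _ => 1)
      (fun _ => zero_le_one) (fun _ => le_rfl) hy hx k hρk
    rw [euler_succ, zero_add]
    refine (ha.norm_curve_sub_eulerStep_le hγ hint hy hh hkT (η := (gridDensity ρ K)⁻¹)
      fun j => ?_).trans ?_
    · rw [norm_sub_rev]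
      exact norm_gridInterp_sub_le hρ hK ha.lip_nonneg (ha.norm_timeAverage_sub_le hh k j)
        (h1.trans hρk)
    · have h2 : 0 ≤ 1 + h * (∑ j, ω j) * Λ := by have := ha.lip_nonneg; positivity
      rw [pow_succ', mul_assoc (1 + h * (∑ j, ω j) * Λ)]
      exact mul_le_mul_of_nonneg_left (ih (by linarith) hρk) h2

/-- The discretization error at all times. -/
theorem norm_curve_sub_euler_le (ha : IsVelocityFamily ω a A A₀ Λ) (hm : 1 ≤ m) (hT : 0 < T)
    (hγ : ContinuousOn γ (Set.Icc 0 T))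
    (hint : ∀ t ∈ Set.Icc 0 T, γ t = x + ∫ s in (0 : ℝ)..t, velocity ω (fun j => a j s) y (γ s))
    (hy : ‖y‖ ≤ 1) {R : ℝ} (hR : 0 < R) (hx : ‖x‖ ≤ R) {K n : ℕ} (hK : 1 ≤ K) (hn : 1 ≤ n)
    {t : ℝ} (ht : t ∈ Set.Icc 0 T) :
    ‖γ t - euler (T / n) ω (fun k j => gridInterp (R + A * T) K (timeAverage a (T / n) k j))
      (fun k => ramp ((T / n)⁻¹ * t - k)) y 0 n x‖ ≤
      Real.exp (Λ * (∑ j, ω j) * T) * (3 * (A * T / n) + 2 * (R + A * T) / K) := by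
  have hA0 := ha.nonneg_of_sum_bound
  have hΛ := ha.lip_nonneg
  have hW0 : 0 ≤ ∑ j, ω j := sum_nonneg fun j _ => ha.weight_nonneg j
  have hn0 : (0 : ℝ) < n := by exact_mod_cast hn
  have hK0 : (0 : ℝ) < K := by exact_mod_cast hK
  set ρ := R + A * T with hρdef
  have hρ : 0 < ρ := by positivity
  set h := T / n with hdef
  have hh : 0 < h := by positivity
  have hnh : n * h = T := by rw [hdef]; field_simp
  set η := (gridDensity ρ K)⁻¹ with hη
  have hη' : η = 2 * ρ / K := by rw [hη, gridDensity, inv_div]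
  have hη0 : 0 ≤ η := by rw [hη']; positivity
  set k := ⌊t / h⌋₊ with hk
  have hkt : k * h ≤ t := (le_div_iff₀ hh).1 (Nat.floor_le (div_nonneg ht.1 hh.le))
  have htk : t ≤ (k + 1) * h := ((div_lt_iff₀ hh).1 (Nat.lt_floor_add_one _)).le
  have hkn : k ≤ n := by
    refine Nat.floor_le_of_le ((div_le_iff₀ hh).2 ?_)
    rw [hnh]; exact ht.2
  have hkρ : R + n * (h * A) ≤ ρ := by rw [← mul_assoc, hnh, hρdef, mul_comm A]
  have hkρ' : R + k * (h * A) ≤ ρ := by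
    have : (k : ℝ) ≤ n := by exact_mod_cast hkn
    exact le_trans (by gcongr) hkρ
  have h1 := ha.norm_curve_sub_euler_node_le hm hγ hint hy hh hρ hx hK k (hkt.trans ht.2) hkρ'
  have h2 := ha.norm_curve_sub_le hγ hint hy ⟨by positivity, hkt.trans ht.2⟩ ht
  have h3 := (ha.velocityBounds hm hh hρ hK).norm_euler_ramp_sub_le hh hA0 hy hx n hkρ (k * h) t
  rw [euler_ramp_node hh y x hkn] at h3
  have h4 : (1 + h * (∑ j, ω j) * Λ) ^ k ≤ Real.exp (Λ * (∑ j, ω j) * T) := by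
    refine one_add_pow_le_exp (by positivity) ?_
    calc k * (h * (∑ j, ω j) * Λ) = Λ * (∑ j, ω j) * (k * h) := by ring
      _ ≤ _ := mul_le_mul_of_nonneg_left (hkt.trans ht.2) (by positivity)
  have h5 : A * |t - k * h| ≤ A * h := by
    refine mul_le_mul_of_nonneg_left ?_ hA0
    rw [abs_of_nonneg (by linarith)]; linarith
  rw [abs_sub_comm] at h3
  set Q := Real.exp (Λ * (∑ j, ω j) * T) with hQ
  have hQ1 : 1 ≤ Q := Real.one_le_exp (by positivity)
  have h6 : (1 + h * (∑ j, ω j) * Λ) ^ k * (A * h + η) ≤ Q * (A * h + η) :=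
    mul_le_mul_of_nonneg_right h4 (by positivity)
  have h7 : A * h ≤ Q * (A * h) := le_mul_of_one_le_left (by positivity) hQ1
  have h8 : A * T / n = A * h := by rw [hdef, mul_div_assoc]
  rw [h8, ← hη']
  set U := euler h ω (fun k j => gridInterp ρ K (timeAverage a h k j)) (fun _ => 1) y 0 k x
  set V := euler h ω (fun k j => gridInterp ρ K (timeAverage a h k j))
    (fun k => ramp (h⁻¹ * t - k)) y 0 n x
  have h9 : ‖γ t - V‖ ≤ ‖γ t - γ (k * h)‖ + ‖γ (k * h) - U‖ + ‖U - V‖ := by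
    calc ‖γ t - V‖ = ‖(γ t - γ (k * h)) + (γ (k * h) - U) + (U - V)‖ := by congr 1; abel
      _ ≤ _ := norm_add₃_le
  have hAh : 0 ≤ A * h := by positivity
  linarith

/-- The composition norm of the time-discretized flow at a fixed time. -/
theorem tripNorm_euler_le (ha : IsVelocityFamily ω a A A₀ Λ) (hm : 1 ≤ m) (hdy : 1 ≤ dy)
    (hT : 0 < T) {R : ℝ} (hR : 0 < R) {D : Set (Fin m → ℝ)} (hD : ∀ x ∈ D, ‖x‖ ≤ R) {K n N : ℕ}
    (hK : 1 ≤ K) (hn : 1 ≤ n) (hN : (n + 1) * (5 * (m + 1) ^ 2 * dy) ≤ N)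
    (G : (Fin (m + dy) → ℝ) → Fin m → ℝ) (t : ℝ)
    (hG : ∀ x ∈ D, ∀ y ∈ paramBox dy, G (Fin.append x y) =
      euler (T / n) ω (fun k j => gridInterp (R + A * T) K (timeAverage a (T / n) k j))
        (fun k => ramp ((T / n)⁻¹ * t - k)) y 0 n x) :
    tripNorm N m (spaceParam D dy) G ≤
      ENNReal.ofReal ((R + 4) * Real.exp ((A + 4 * m * Λ * ∑ j, ω j) * T)) := by
  have hA0 := ha.nonneg_of_sum_bound
  have hΛ := ha.lip_nonneg
  have hW0 : 0 ≤ ∑ j, ω j := sum_nonneg fun j _ => ha.weight_nonneg j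
  have hn1 : (1 : ℝ) ≤ n := by exact_mod_cast hn
  have hn0 : (0 : ℝ) < n := by linarith
  set ρ := R + A * T with hρdef
  have hρ : 0 < ρ := by positivity
  set h := T / n with hdef
  have hh : 0 < h := by positivity
  have hnh : n * h = T := by rw [hdef]; field_simp
  have hhT : h ≤ T := by rw [← hnh]; exact le_mul_of_one_le_left hh.le hn1
  have hnhA : n * (h * A) = A * T := by rw [← mul_assoc, hnh, mul_comm]
  set f := fun k j => gridInterp ρ K (timeAverage a h k j) with hf
  set τ : ℕ → ℝ := fun k => ramp (h⁻¹ * t - k) with hτ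
  refine iInf_le_of_le (flowRep h ω f τ 0 n) (iInf_le_of_le ?_ (iInf_le_of_le
    (sparsity_flowRep_le hm h ω f τ 0 n) (iInf_le_of_le
      ((complexity_flowRep_le hdy h ω f τ 0 n).trans hN) ?_)))
  · rintro _ ⟨x, hx, y, hy, rfl⟩
    rw [eval_flowRep ha.weight_nonneg, fstPart_append, sndPart_append, hG x hx y hy]
  · set W := ∑ j, ω j with hW
    have hexp : Real.exp ((A + 4 * m * Λ * W) * T) =
        Real.exp (A * T) * Real.exp (T * W * (4 * m * Λ)) := by
      rw [← Real.exp_add]; congr 1; ring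
    rw [hexp]
    set P := Real.exp (A * T) with hP
    set Q := Real.exp (T * W * (4 * m * Λ)) with hQ
    have hP1 : A * T + 1 ≤ P := Real.add_one_le_exp _
    have hQ1 : T * W * (4 * m * Λ) + 1 ≤ Q := Real.add_one_le_exp _
    have hAT : 0 ≤ A * T := by positivity
    have hTW : 0 ≤ T * W * (4 * m * Λ) := by positivity
    have hP0 : 1 ≤ P := by linarith
    have hQ0 : 1 ≤ Q := by linarith
    have hPQ : P ≤ P * Q := le_mul_of_one_le_right (by linarith) hQ0
    have hPQ' : Q ≤ P * Q := le_mul_of_one_le_left (by linarith) hP0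
    have hRP : ρ ≤ (R + 1) * P := by
      have : R ≤ R * P := le_mul_of_one_le_right hR.le hP0
      linarith
    have hhW : h * W * (4 * m * Λ) ≤ Q := by
      have : h * W * (4 * m * Λ) ≤ T * W * (4 * m * Λ) := by gcongr
      linarith
    have hRPQ : 0 ≤ R * (P * Q) := by positivity
    have hPQ0 : 0 ≤ P * Q := by positivity
    refine reg_flowRep_le (M := 4 * m * Λ) (ha.velocityBounds hm hh hρ hK) hh.le hA0
      (fun _ => ramp_nonneg _) (fun _ => ramp_le_one _) ?_ ?_ ?_ n 0 hR.le ?_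
      (by rw [hnhA, hρdef]) ?_
    · have : R * P ≤ R * (P * Q) := by gcongr
      linarith
    · linarith
    · calc h * W * (4 * m * Λ * ρ) = h * W * (4 * m * Λ) * ρ := by ring
        _ ≤ Q * ((R + 1) * P) := by gcongr
        _ ≤ (R + 4) * (P * Q) := by linarith
    · rintro _ ⟨x, hx, y, hy, rfl⟩
      rw [fstPart_append, sndPart_append]
      exact ⟨hD x hx, (pi_norm_le_iff_of_nonneg zero_le_one).2 fun j =>
        abs_le.2 ⟨hy.1 j, hy.2 j⟩⟩
    · have h1 : (1 + h * W * (4 * m * Λ)) ^ n ≤ Q := by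
        refine one_add_pow_le_exp (by positivity) (le_of_eq ?_)
        rw [← hnh]; ring
      rw [hnhA]
      calc _ ≤ Q * (3 * P) := mul_le_mul h1 (by linarith) (by positivity) (by linarith)
        _ ≤ (R + 4) * (P * Q) := by linarith

/-- Networks for the characteristics, with `n` time steps and `K` grid cells per direction. -/
theorem exists_net (ha : IsVelocityFamily ω a A A₀ Λ) (hm : 1 ≤ m) (hdy : 1 ≤ dy)
    (hT : 0 < T) {R : ℝ} (hR : 0 < R) {D : Set (Fin m → ℝ)} (hD : ∀ x ∈ D, ‖x‖ ≤ R)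
    {z : ℝ → (Fin m → ℝ) → (Fin dy → ℝ) → Fin m → ℝ} (hz : IsCharField T ω a z) {K n : ℕ}
    (hK : 1 ≤ K) (hn : 1 ≤ n) :
    ∃ net : Net (m + dy + 1) m,
      ApproxWithin T D z net
        (Real.exp (Λ * (∑ j, ω j) * T) * (3 * (A * T / n) + 2 * (R + A * T) / K)) ∧
      net.size ≤ 60 * (m + 2) ^ 2 * 2 ^ m * (dy * n * K ^ m) ∧
      TimeLipschitz T D net A ∧
      CompStable T D net net.size ((R + 4) * Real.exp ((A + 4 * m * Λ * ∑ j, ω j) * T)) := by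
  have hA0 := ha.nonneg_of_sum_bound
  have hn0 : (0 : ℝ) < n := by exact_mod_cast hn
  have hbox : ∀ y ∈ paramBox dy, ‖y‖ ≤ 1 := fun y hy =>
    (pi_norm_le_iff_of_nonneg zero_le_one).2 fun j => abs_le.2 ⟨hy.1 j, hy.2 j⟩
  obtain ⟨net₀, h1, h2⟩ := exists_net_euler hdy (R + A * T) K (T / n)⁻¹ (T / n) ω
    (timeAverage a (T / n)) n
  obtain ⟨net, h3, h4, h5⟩ := net₀.exists_le_size ((n + 1) * (5 * (m + 1) ^ 2 * dy))
  have h1' : ∀ t x y, net.evalTXY t x y = euler (T / n) ω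
      (fun k j => gridInterp (R + A * T) K (timeAverage a (T / n) k j))
      (fun k => ramp ((T / n)⁻¹ * t - k)) y 0 n x := fun t x y => by
    rw [← h1, Net.evalTXY, Net.evalTXY, h3]
  refine ⟨net, fun t ht x hx y hy => ?_, ?_, fun t _ t' _ x hx y hy => ?_, fun t _ => ?_⟩
  · rw [h1']
    exact ha.norm_curve_sub_euler_le hm hT (hz x y hy).1 (hz x y hy).2 (hbox y hy) hR (hD x hx)
      hK hn ht
  · have hK' : (K + 1) ^ m ≤ 2 ^ m * K ^ m := by
      rw [← mul_pow]; exact Nat.pow_le_pow_left (by omega) m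
    set Y := 2 ^ m * K ^ m with hY
    have hY1 : 1 ≤ Y := Nat.one_le_iff_ne_zero.2 (by positivity)
    have hdY : dy ≤ dy * Y := Nat.le_mul_of_pos_right _ hY1
    have hdn : dy * Y ≤ dy * Y * n := Nat.le_mul_of_pos_right _ hn
    set Z := dy * Y * n with hZ
    have hZ1 : 1 ≤ Z := hdy.trans (hdY.trans hdn)
    have e1 : (n + 1) * (20 * (m + 2) ^ 2 * (dy * (K + 1) ^ m)) ≤ 40 * (m + 2) ^ 2 * Z := by
      calc _ ≤ (n + n) * (20 * (m + 2) ^ 2 * (dy * Y)) := by gcongr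
        _ = _ := by rw [hZ]; ring
    have e2 : (n + 1) * (5 * (m + 1) ^ 2 * dy) ≤ 10 * (m + 2) ^ 2 * Z := by
      calc _ ≤ (n + n) * (5 * (m + 2) ^ 2 * (dy * Y)) := by gcongr; omega
        _ = _ := by rw [hZ]; ring
    have e3 : 2 * (m + dy + 1) ≤ 10 * (m + 2) ^ 2 * Z := by
      have : m * 1 ≤ m * Z := Nat.mul_le_mul_left _ hZ1
      nlinarith
    calc net.size ≤ 60 * (m + 2) ^ 2 * Z := by linarith
      _ = _ := by rw [hZ, hY]; ring
  · rw [h1', h1']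
    refine (ha.velocityBounds hm (by positivity) (by positivity) hK).norm_euler_ramp_sub_le
      (by positivity) hA0 (hbox y hy) (hD x hx) n (le_of_eq ?_) t t'
    field_simp
  · exact ha.tripNorm_euler_le hm hdy hT hR hD hK hn h4 _ t fun x _ y _ => h1' t x y

end IsVelocityFamily

end Core

/-! ### Monotonicity of the error and stability bounds -/

section Mono

variable {m dy : ℕ} {T : ℝ} {D : Set (Fin m → ℝ)} {net : Net (m + dy + 1) m}

theorem ApproxWithin.mono {z : ℝ → (Fin m → ℝ) → (Fin dy → ℝ) → Fin m → ℝ} {ε ε' : ℝ}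
    (h : ApproxWithin T D z net ε) (hε : ε ≤ ε') : ApproxWithin T D z net ε' :=
  fun t ht x hx y hy => (h t ht x hx y hy).trans hε

theorem TimeLipschitz.mono {K K' : ℝ} (h : TimeLipschitz T D net K) (hK : K ≤ K') :
    TimeLipschitz T D net K' :=
  fun t ht t' ht' x hx y hy => (h t ht t' ht' x hx y hy).trans
    (mul_le_mul_of_nonneg_right hK (abs_nonneg _))

theorem CompStable.mono {N N' : ℕ} {K K' : ℝ} (h : CompStable T D net N K) (hN : N ≤ N')
    (hK : K ≤ K') : CompStable T D net N' K' := by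
  intro t ht
  refine le_trans ?_ ((h t ht).trans (ENNReal.ofReal_le_ofReal hK))
  exact iInf_mono fun r => iInf_mono fun _ => iInf_mono fun _ => iInf_mono' fun hc =>
    ⟨hc.trans hN, le_rfl⟩

end Mono

/-! ### The trivial approximation by the initial value -/

section ProjNet

variable {m dy : ℕ} {D : Set (Fin m → ℝ)}

theorem compStable_projNet {R : ℝ} (hR : 1 ≤ R) (hD : ∀ x ∈ D, ‖x‖ ≤ R) (T : ℝ) :
    CompStable T D (projNet m dy) m R := by
  intro t _
  have hproj : (Matrix.of fun (i : Fin m) (j : Fin (m + dy)) =>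
      if j = Fin.castAdd dy i then (1 : ℝ) else 0).mulVec = fstPart := by
    funext v; exact eval_last_proj v
  refine iInf_le_of_le (.last (Matrix.of fun i j => if j = Fin.castAdd dy i then 1 else 0))
    (iInf_le_of_le ?_ (iInf_le_of_le (Nat.zero_le _) (iInf_le_of_le ?_ (max_le ?_ ?_))))
  · rintro _ ⟨x, hx, y, hy, rfl⟩
    change Matrix.mulVec _ _ = (projNet m dy).evalTXY t x y
    rw [hproj, evalTXY_projNet, fstPart_append]
  · refine (sum_le_sum (g := fun _ => 1) fun i _ => ?_).trans (by simp)
    rw [hproj]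
    exact numVars_coord_le _
  · rw [ENNReal.one_le_ofReal]; exact hR
  · rw [hproj]
    refine lipNormOn_le (by linarith) ?_ fun v _ v' _ =>
      (norm_fstPart_le (v - v')).trans (le_mul_of_one_le_left (norm_nonneg _) hR)
    rintro _ ⟨x, hx, y, hy, rfl⟩
    rw [fstPart_append]
    exact hD x hx

end ProjNet

/-! ### The choice of the discretization parameters -/

section Parameters

variable {m dy : ℕ} {ω : Fin dy → ℝ} {a : Fin dy → ℝ → (Fin m → ℝ) → Fin m → ℝ} {A A₀ Λ T R : ℝ}
  {D : Set (Fin m → ℝ)} {z : ℝ → (Fin m → ℝ) → (Fin dy → ℝ) → Fin m → ℝ}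

/-- The constant in the size of the networks. -/
def sizeConst (m : ℕ) : ℝ := 60 * (m + 2) ^ 2 * 2 ^ m

theorem one_le_sizeConst (m : ℕ) : 1 ≤ sizeConst m := by
  have h1 : (1 : ℝ) ≤ 2 ^ m := one_le_pow₀ (by norm_num)
  have h2 : (0 : ℝ) ≤ m := by positivity
  unfold sizeConst
  nlinarith [mul_nonneg h2 (sub_nonneg.2 h1), mul_nonneg (mul_nonneg h2 h2) (sub_nonneg.2 h1)]

theorem add_mul_le_mul_exp {R s : ℝ} (hR : 0 ≤ R) (hs : 0 ≤ s) :
    R + s ≤ (R + 1) * Real.exp s := by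
  have h1 := Real.add_one_le_exp s
  have h2 : 0 ≤ R * s := by positivity
  nlinarith

theorem IsVelocityFamily.exists_net_of_accuracy (ha : IsVelocityFamily ω a A A₀ Λ) (hm : 1 ≤ m)
    (hdy : 1 ≤ dy) (hT : 0 < T) (hA : 0 < A) (hR : 0 < R) (hD : ∀ x ∈ D, ‖x‖ ≤ R)
    (hz : IsCharField T ω a z) {δ : ℝ} (hδ0 : 0 < δ) (hδ1 : δ ≤ 1) (hδA : δ ≤ A * T) :
    ∃ net : Net (m + dy + 1) m,
      ApproxWithin T D z net (Real.exp ((A + Λ * ∑ j, ω j) * T) * δ) ∧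
      (net.size : ℝ) ≤ 7 * sizeConst m * (4 * R + 5) ^ m * (dy * A * T * δ⁻¹ ^ (m + 1)) ∧
      TimeLipschitz T D net A ∧
      CompStable T D net net.size ((R + 4) * Real.exp ((A + 4 * m * Λ * ∑ j, ω j) * T)) := by
  have hAT : 0 < A * T := by positivity
  -- Each of the two discretizations contributes half of the error.
  set n := ⌈6 * (A * T) / δ⌉₊ with hn
  set K := ⌈4 * (R + 1) / δ⌉₊ with hK
  have hn1 : 6 * (A * T) / δ ≤ n := Nat.le_ceil _
  have hK1 : 4 * (R + 1) / δ ≤ K := Nat.le_ceil _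
  have hn0 : (0 : ℝ) < n := lt_of_lt_of_le (by positivity) hn1
  have hK0 : (0 : ℝ) < K := lt_of_lt_of_le (by positivity) hK1
  have h1n : 1 ≤ n := by exact_mod_cast hn0
  have h1K : 1 ≤ K := by exact_mod_cast hK0
  have hn2 : n ≤ 7 * (A * T) * δ⁻¹ := by
    have h1 : (n : ℝ) ≤ 6 * (A * T) / δ + 1 := (Nat.ceil_lt_add_one (by positivity)).le
    have h2 : 1 ≤ A * T * δ⁻¹ := by
      rw [← div_eq_mul_inv]; exact (one_le_div hδ0).2 hδA
    rw [div_eq_mul_inv] at h1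
    linarith
  have hK2 : K ≤ (4 * R + 5) * δ⁻¹ := by
    have h1 : (K : ℝ) ≤ 4 * (R + 1) / δ + 1 := (Nat.ceil_lt_add_one (by positivity)).le
    have h2 : 1 ≤ δ⁻¹ := (one_le_inv₀ hδ0).2 hδ1
    rw [div_eq_mul_inv] at h1
    linarith
  obtain ⟨net, h1, h2, h3, h4⟩ := ha.exists_net hm hdy hT hR hD hz h1K h1n
  refine ⟨net, h1.mono ?_, ?_, h3, h4⟩
  · have e1 : 3 * (A * T / n) ≤ δ / 2 := by
      rw [div_le_iff₀ hδ0] at hn1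
      rw [← mul_div_assoc, div_le_iff₀ hn0]
      linarith
    have e2 : 2 * (R + A * T) / K ≤ Real.exp (A * T) * δ / 2 := by
      rw [div_le_iff₀ hδ0] at hK1
      rw [div_le_iff₀ hK0]
      have h5 := add_mul_le_mul_exp hR.le hAT.le
      have h6 := mul_le_mul_of_nonneg_left hK1 (Real.exp_pos (A * T)).le
      linarith
    have e3 : δ ≤ Real.exp (A * T) * δ :=
      le_mul_of_one_le_left hδ0.le (Real.one_le_exp hAT.le)
    calc _ ≤ Real.exp (Λ * (∑ j, ω j) * T) * (Real.exp (A * T) * δ) := by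
          gcongr; linarith
      _ = _ := by rw [← mul_assoc, ← Real.exp_add]; congr 2; ring
  · have hc : 0 ≤ sizeConst m := zero_le_one.trans (one_le_sizeConst m)
    have h5 : (net.size : ℝ) ≤ sizeConst m * (dy * n * K ^ m) := by
      unfold sizeConst; exact_mod_cast h2
    calc (net.size : ℝ) ≤ sizeConst m * (dy * n * K ^ m) := h5
      _ ≤ sizeConst m * (dy * (7 * (A * T) * δ⁻¹) * ((4 * R + 5) * δ⁻¹) ^ m) := by gcongr
      _ = _ := by rw [mul_pow]; ring

/-- The networks of prescribed size: `q` balances the contributions of the discretizations in time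
and in space. If `q` is so large that it admits no time step or no grid cell, then the trivial
approximation by the initial value suffices. -/
theorem IsVelocityFamily.exists_net_of_size (ha : IsVelocityFamily ω a A A₀ Λ) (hm : 1 ≤ m)
    (hdy : 1 ≤ dy) (hT : 0 < T) (hA : 0 < A) (hR : 1 ≤ R) (hD : ∀ x ∈ D, ‖x‖ ≤ R)
    (hz : IsCharField T ω a z) {N : ℕ} (hmN : m ≤ N) {q : ℝ} (hq : 0 < q)
    (hqN : A * T * dy = N * q ^ (m + 1)) :
    ∃ net : Net (m + dy + 1) m,
      net.size ≤ N ∧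
      ApproxWithin T D z net ((3 + 8 * sizeConst m * (R + 1)) *
        (Real.exp ((A + Λ * ∑ j, ω j) * T) * q)) ∧
      TimeLipschitz T D net A ∧
      CompStable T D net N ((R + 4) * Real.exp ((A + 4 * m * Λ * ∑ j, ω j) * T)) := by
  have hΛ := ha.lip_nonneg
  have hW0 : 0 ≤ ∑ j, ω j := sum_nonneg fun j _ => ha.weight_nonneg j
  have hAT : 0 < A * T := by positivity
  have hc := one_le_sizeConst m
  set c := sizeConst m with hcdef
  have hLexp : Real.exp ((A + Λ * ∑ j, ω j) * T) =
      Real.exp (Λ * (∑ j, ω j) * T) * Real.exp (A * T) := by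
    rw [← Real.exp_add]; congr 1; ring
  have hQ1 : 1 ≤ Real.exp (Λ * (∑ j, ω j) * T) := Real.one_le_exp (by positivity)
  have hP1 : A * T + 1 ≤ Real.exp (A * T) := Real.add_one_le_exp _
  have hLP : Real.exp (A * T) ≤ Real.exp ((A + Λ * ∑ j, ω j) * T) := by
    rw [hLexp]; exact le_mul_of_one_le_left (Real.exp_pos _).le hQ1
  by_cases hcase : q < A * T ∧ 2 * c * q ≤ 1
  · obtain ⟨hqA, hqc⟩ := hcase
    -- The factor `2 * c` in the grid width keeps the size bound `c * (dy * n * K ^ m)` below `N`.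
    set n := ⌈A * T / q⌉₊ with hn
    set K := ⌊(2 * c * q)⁻¹⌋₊ with hK
    have hn1 : A * T / q ≤ n := Nat.le_ceil _
    have hn0 : (0 : ℝ) < n := lt_of_lt_of_le (by positivity) hn1
    have h1n : 1 ≤ n := by exact_mod_cast hn0
    have hn2 : n ≤ 2 * (A * T / q) := by
      have h1 := (Nat.ceil_lt_add_one (a := A * T / q) (by positivity)).le
      have h2 : 1 ≤ A * T / q := (one_le_div hq).2 hqA.le
      linarith
    have hcq : 0 < 2 * c * q := by positivity
    have hinv : 1 ≤ (2 * c * q)⁻¹ := (one_le_inv₀ hcq).2 hqc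
    have h1K : 1 ≤ K := Nat.le_floor (by simpa using hinv)
    have hK0 : (1 : ℝ) ≤ K := by exact_mod_cast h1K
    have hK1 : (K : ℝ) ≤ (2 * c * q)⁻¹ := Nat.floor_le (by positivity)
    have hK2 : (2 * c * q)⁻¹ ≤ 2 * K := by
      have := (Nat.lt_floor_add_one ((2 * c * q)⁻¹)).le
      linarith
    obtain ⟨net, h1, h2, h3, h4⟩ := ha.exists_net hm hdy hT (by linarith) hD hz h1K h1n
    have hsize : net.size ≤ N := by
      have h5 : (net.size : ℝ) ≤ c * (dy * n * K ^ m) := by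
        rw [hcdef, sizeConst]; exact_mod_cast h2
      have h6 : ((2 * c)⁻¹) ^ m ≤ (2 * c)⁻¹ :=
        pow_le_of_le_one (by positivity) (inv_le_one_of_one_le₀ (by linarith)) (by omega)
      have h7 : (net.size : ℝ) ≤ N := by
        calc (net.size : ℝ) ≤ c * (dy * n * K ^ m) := h5
          _ ≤ c * (dy * (2 * (A * T / q)) * ((2 * c * q)⁻¹) ^ m) := by gcongr
          _ = c * (dy * (2 * (A * T / q)) * (((2 * c)⁻¹) ^ m * (q⁻¹) ^ m)) := by
              rw [mul_inv (2 * c), mul_pow]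
          _ ≤ c * (dy * (2 * (A * T / q)) * ((2 * c)⁻¹ * (q⁻¹) ^ m)) := by gcongr
          _ = (A * T * dy) * (q⁻¹) ^ (m + 1) := by
              rw [pow_succ, div_eq_mul_inv]
              generalize q⁻¹ = p
              field_simp
          _ = N := by rw [hqN, mul_assoc, ← mul_pow, mul_inv_cancel₀ hq.ne', one_pow, mul_one]
      exact_mod_cast h7
    refine ⟨net, hsize, h1.mono ?_, h3, h4.mono hsize le_rfl⟩
    have e1 : 3 * (A * T / n) ≤ 3 * q := by
      rw [div_le_iff₀ hq] at hn1
      gcongr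
      rw [div_le_iff₀ hn0]
      linarith
    have e2 : 2 * (R + A * T) / K ≤ 8 * c * (R + 1) * (Real.exp (A * T) * q) := by
      rw [inv_le_comm₀ hcq (by positivity)] at hK2
      have h5 := add_mul_le_mul_exp (by linarith : 0 ≤ R) hAT.le
      calc 2 * (R + A * T) / K = 4 * (R + A * T) * (2 * (K : ℝ))⁻¹ := by field_simp; ring
        _ ≤ 4 * ((R + 1) * Real.exp (A * T)) * (2 * c * q) := by gcongr
        _ = _ := by ring
    have e3 : q ≤ Real.exp (A * T) * q := le_mul_of_one_le_left hq.le (by linarith)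
    calc _ ≤ Real.exp (Λ * (∑ j, ω j) * T) *
          ((3 + 8 * c * (R + 1)) * (Real.exp (A * T) * q)) := by gcongr; linarith
      _ = _ := by rw [hLexp]; ring
  · have hbound : A * T ≤ 2 * c * (Real.exp ((A + Λ * ∑ j, ω j) * T) * q) := by
      rcases not_and_or.1 hcase with h | h
      · rw [not_lt] at h
        calc A * T ≤ 1 * (1 * q) := by linarith
          _ ≤ _ := by gcongr <;> linarith
      · rw [not_le] at h
        calc A * T ≤ Real.exp ((A + Λ * ∑ j, ω j) * T) * 1 := by linarith
          _ ≤ Real.exp ((A + Λ * ∑ j, ω j) * T) * (2 * c * q) := by gcongr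
          _ = _ := by ring
    refine ⟨projNet m dy, size_projNet_le.trans hmN, fun t ht x hx y hy => ?_,
      fun t _ t' _ x _ y _ => ?_, (compStable_projNet hR hD T).mono hmN ?_⟩
    · have hy1 : ‖y‖ ≤ 1 :=
        (pi_norm_le_iff_of_nonneg zero_le_one).2 fun j => abs_le.2 ⟨hy.1 j, hy.2 j⟩
      have h0 : (0 : ℝ) ∈ Set.Icc 0 T := ⟨le_rfl, hT.le⟩
      have h5 := ha.norm_curve_sub_le (hz x y hy).1 (hz x y hy).2 hy1 h0 ht
      have h6 : z 0 x y = x := by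
        rw [(hz x y hy).2 0 h0, intervalIntegral.integral_same, add_zero]
      rw [evalTXY_projNet]
      rw [h6, sub_zero, abs_of_nonneg ht.1] at h5
      have h7 : A * t ≤ A * T := mul_le_mul_of_nonneg_left ht.2 hA.le
      have h8 : 0 < Real.exp ((A + Λ * ∑ j, ω j) * T) * q := by positivity
      have h9 : 2 * c ≤ 3 + 8 * c * (R + 1) := by nlinarith
      exact h5.trans (h7.trans (hbound.trans (mul_le_mul_of_nonneg_right h9 h8.le)))
    · rw [evalTXY_projNet, evalTXY_projNet, sub_self, norm_zero]
      positivity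
    · have : 1 ≤ Real.exp ((A + 4 * m * Λ * ∑ j, ω j) * T) := Real.one_le_exp (by positivity)
      nlinarith

end Parameters

/-! ### Reduction to velocity components defined for all times -/

section Extension

variable {m dy : ℕ} {ω : Fin dy → ℝ} {a : Fin dy → ℝ → (Fin m → ℝ) → Fin m → ℝ} {A A₀ Λ T : ℝ}

/-- The extension by zero of the velocity components outside of `[0, T]`. -/
def extendZero (T : ℝ) (a : Fin dy → ℝ → (Fin m → ℝ) → Fin m → ℝ) (j : Fin dy) (t : ℝ)
    (x : Fin m → ℝ) : Fin m → ℝ :=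
  (Set.Icc 0 T).indicator (fun t => a j t x) t

theorem isVelocityFamily_extendZero (hm : 1 ≤ m) (hdy : 1 ≤ dy) (hT : 0 < T) (hA : 0 < A)
    (hω : ∀ j, 0 ≤ ω j) (hmeas : ∀ j x, Measurable fun t => a j t x)
    (hbd : ∀ j, ∀ t ∈ Set.Icc 0 T, ∀ x, ‖a j t x‖ ≤ A₀)
    (hlip : ∀ j, ∀ t ∈ Set.Icc 0 T, ∀ x x', ‖a j t x - a j t x'‖ ≤ Λ * ‖x - x'‖)
    (hsum : ∀ t ∈ Set.Icc 0 T, ∀ x, ∑ j, ‖ω j • a j t x‖ ≤ A) :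
    IsVelocityFamily ω (extendZero T a) A A₀ Λ := by
  have h0 : (0 : ℝ) ∈ Set.Icc 0 T := ⟨le_rfl, hT.le⟩
  have hA₀ : 0 ≤ A₀ := (norm_nonneg _).trans (hbd ⟨0, hdy⟩ 0 h0 0)
  have hΛ : 0 ≤ Λ := by
    have : Nonempty (Fin m) := ⟨⟨0, hm⟩⟩
    have h1 := hlip ⟨0, hdy⟩ 0 h0 1 0
    rw [sub_zero, norm_one, mul_one] at h1
    exact (norm_nonneg _).trans h1
  refine ⟨hω, hΛ, fun j x => (hmeas j x).indicator measurableSet_Icc, fun j t x => ?_,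
    fun j t x x' => ?_, fun t x => ?_⟩ <;> by_cases ht : t ∈ Set.Icc 0 T
  · simpa [extendZero, Set.indicator_of_mem ht] using hbd j t ht x
  · simpa [extendZero, Set.indicator_of_notMem ht] using hA₀
  · simpa only [extendZero, Set.indicator_of_mem ht] using hlip j t ht x x'
  · simp only [extendZero, Set.indicator_of_notMem ht, sub_self, norm_zero]
    positivity
  · simpa only [extendZero, Set.indicator_of_mem ht] using hsum t ht x
  · simp only [extendZero, Set.indicator_of_notMem ht, smul_zero, norm_zero, sum_const_zero]
    exact hA.le

theorem IsCharField.extendZero {z : ℝ → (Fin m → ℝ) → (Fin dy → ℝ) → Fin m → ℝ}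
    (hz : IsCharField T ω a z) : IsCharField T ω (extendZero T a) z := by
  refine fun x y hy => ⟨(hz x y hy).1, fun t ht => ?_⟩
  rw [(hz x y hy).2 t ht]
  congr 1
  refine intervalIntegral.integral_congr fun s hs => ?_
  rw [Set.uIcc_of_le ht.1] at hs
  have hs' : s ∈ Set.Icc 0 T := ⟨hs.1, hs.2.trans ht.2⟩
  simp only [convField, TransportDNN.extendZero, Set.indicator_of_mem hs']

end Extension

/-! ### The rates -/

theorem one_le_abs_logb_two {r : ℝ} (hr : 2 ≤ r) : 1 ≤ |Real.logb 2 r| := by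
  refine le_trans ?_ (le_abs_self _)
  rw [Real.le_logb_iff_rpow_le (by norm_num) (by linarith), Real.rpow_one]
  exact hr

theorem rpow_le_inv_growth {m dy : ℕ} (hm : 1 ≤ m) {A T r : ℝ} (hAT : 0 < A * T)
    (hr : 2 ≤ r / dy) :
    (A * T / (r / dy)) ^ (1 / ((m : ℝ) + 1)) ≤ (growth m dy A T r)⁻¹ := by
  have hm1 : (1 : ℝ) ≤ m := by exact_mod_cast hm
  have hlog := one_le_abs_logb_two hr
  have hr0 : 0 < r / dy := by linarith
  unfold growth
  set s := r / dy
  set l := |Real.logb 2 s|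
  have h1 : (A * T * (m : ℝ) ^ 2) ^ (-(1 / ((m : ℝ) + 1))) ≤
      (A * T) ^ (-(1 / ((m : ℝ) + 1))) :=
    Real.rpow_le_rpow_of_nonpos hAT
      (le_mul_of_one_le_right hAT.le (one_le_pow₀ hm1)) (by
        rw [neg_nonpos]; positivity)
  have h2 : l ^ (-(2 / ((m : ℝ) + 1))) ≤ 1 :=
    Real.rpow_le_one_of_one_le_of_nonpos hlog (by rw [neg_nonpos]; positivity)
  have h3 : 0 < l := by linarith
  rw [le_inv_comm₀ (by positivity) (by positivity)]
  calc _ ≤ (A * T) ^ (-(1 / ((m : ℝ) + 1))) * s ^ (1 / ((m : ℝ) + 1)) * 1 := by gcongr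
    _ = _ := by
        rw [mul_one, Real.div_rpow hAT.le hr0.le, Real.rpow_neg hAT.le, inv_div]
        field_simp

end TransportDNN

end

theorem theorem4p6 (m : ℕ) (hm : 1 ≤ m) :
    ∃ c₃ : ℝ, 0 < c₃ ∧ ∀ D : Set (Fin m → ℝ), Bornology.IsBounded D →
    ∃ C : ℝ, 0 < C ∧
    ∀ (dy : ℕ) (_ : 1 ≤ dy) (T A A₀ Λ : ℝ) (ω : Fin dy → ℝ)
      (a : Fin dy → ℝ → (Fin m → ℝ) → Fin m → ℝ)
      (z : ℝ → (Fin m → ℝ) → (Fin dy → ℝ) → Fin m → ℝ),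
      0 < T → 0 < A → (∀ j, 0 ≤ ω j) →
      (∀ j x, Measurable fun t => a j t x) →
      (∀ j, ∀ t ∈ Set.Icc 0 T, ∀ x, ‖a j t x‖ ≤ A₀) →
      (∀ j, ∀ t ∈ Set.Icc 0 T, ∀ x x', ‖a j t x - a j t x'‖ ≤ Λ * ‖x - x'‖) →
      (∀ t ∈ Set.Icc 0 T, ∀ x, ∑ j, ‖ω j • a j t x‖ ≤ A) →
      TransportDNN.IsCharField T ω a z →
      ∀ L L' : ℝ, L = A + Λ * ∑ j, ω j →
        L' = A + T⁻¹ + c₃ * (1 + A₀) * Λ * ∑ j, ω j →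
      (∀ ε : ℝ, 0 < ε → 2 * ε ≤ Real.exp (L * T) → ε ≤ A * T * Real.exp (L * T) →
        ∃ net : TransportDNN.Net (m + dy + 1) m,
          TransportDNN.ApproxWithin T D z net ε ∧
          (net.size : ℝ) ≤ C * (dy * (m : ℝ) ^ 2 * A * T * (Real.exp (L * T) / ε) ^ (m + 1) *
            |Real.logb 2 (Real.exp (L * T) / ε)| ^ 2) ∧
          TransportDNN.TimeLipschitz T D net (C * (A + T⁻¹)) ∧
          TransportDNN.CompStable T D net net.size (C * Real.exp (L' * T))) ∧
      (∀ N : ℕ, 2 * dy ≤ N → m ≤ N →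
        ∃ net : TransportDNN.Net (m + dy + 1) m,
          net.size ≤ N ∧
          TransportDNN.ApproxWithin T D z net
            (C * (Real.exp (L * T) * (TransportDNN.growth m dy A T N)⁻¹)) ∧
          TransportDNN.TimeLipschitz T D net (C * (A + T⁻¹)) ∧
          TransportDNN.CompStable T D net N (C * Real.exp (L' * T))) := by
  have hm1 : (1 : ℝ) ≤ m := by exact_mod_cast hm
  refine ⟨4 * m, by positivity, fun D hDb => ?_⟩
  obtain ⟨R, hR, hD⟩ : ∃ R : ℝ, 1 ≤ R ∧ ∀ x ∈ D, ‖x‖ ≤ R := by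
    obtain ⟨R, hR⟩ := hDb.exists_norm_le
    exact ⟨max R 1, le_max_right _ _, fun x hx => (hR x hx).trans (le_max_left _ _)⟩
  have hc := TransportDNN.one_le_sizeConst m
  set c := TransportDNN.sizeConst m with hcdef
  set C₁ := 7 * c * (4 * R + 5) ^ m with hC₁
  have hC₁0 : 0 ≤ C₁ := by positivity
  have hcR : 0 ≤ 8 * c * (R + 1) := by positivity
  set C := C₁ + 8 * c * (R + 1) + (R + 7) with hC
  have hC0 : 1 ≤ C := by linarith
  refine ⟨C, by linarith, ?_⟩
  intro dy hdy T A A₀ Λ ω a z hT hA hω hmeas hbd hlip hsum hz L L' hL hL'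
  have ha := TransportDNN.isVelocityFamily_extendZero hm hdy hT hA hω hmeas hbd hlip hsum
  have hz' := hz.extendZero
  have hΛ := ha.lip_nonneg
  have hA₀ : 0 ≤ A₀ := (norm_nonneg _).trans (ha.bound ⟨0, hdy⟩ 0 0)
  have hW0 : 0 ≤ ∑ j, ω j := Finset.sum_nonneg fun j _ => hω j
  have hAT : 0 < A * T := by positivity
  have hdy0 : (0 : ℝ) < dy := by exact_mod_cast hdy
  have htime : A ≤ C * (A + T⁻¹) := by
    have h1 : 0 < T⁻¹ := by positivity
    calc A ≤ 1 * (A + T⁻¹) := by linarith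
      _ ≤ _ := by gcongr
  have hcomp : (R + 4) * Real.exp ((A + 4 * m * Λ * ∑ j, ω j) * T) ≤ C * Real.exp (L' * T) := by
    have h1 : A + 4 * m * Λ * ∑ j, ω j ≤ L' := by
      have h2 : 0 < T⁻¹ := by positivity
      have h3 : 0 ≤ 4 * m * A₀ * Λ * ∑ j, ω j := by positivity
      rw [hL']
      linarith
    gcongr
    linarith
  refine ⟨fun ε hε hε2 hεA => ?_, fun N hN hmN => ?_⟩
  · have hE := Real.exp_pos (L * T)
    obtain ⟨net, h1, h2, h3, h4⟩ := ha.exists_net_of_accuracy hm hdy hT hA (by linarith) hD hz'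
      (δ := ε / Real.exp (L * T)) (by positivity) ((div_le_one hE).2 (by linarith))
      ((div_le_iff₀ hE).2 hεA)
    refine ⟨net, h1.mono (le_of_eq ?_), h2.trans ?_, h3.mono htime, h4.mono le_rfl hcomp⟩
    · rw [← hL]; field_simp
    · rw [inv_div]
      set s := Real.exp (L * T) / ε with hs
      have hs2 : 2 ≤ s := (le_div_iff₀ hε).2 hε2
      have h5 : 1 ≤ |Real.logb 2 s| ^ 2 := one_le_pow₀ (TransportDNN.one_le_abs_logb_two hs2)
      have h6 : (1 : ℝ) ≤ (m : ℝ) ^ 2 := one_le_pow₀ hm1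
      have h7 : 0 < s := by linarith
      calc C₁ * (dy * A * T * s ^ (m + 1)) ≤ C * (dy * A * T * s ^ (m + 1)) := by
            gcongr; linarith
        _ ≤ C * (dy * A * T * s ^ (m + 1) * ((m : ℝ) ^ 2 * |Real.logb 2 s| ^ 2)) := by
            refine mul_le_mul_of_nonneg_left (le_mul_of_one_le_right (by positivity) ?_)
              (by linarith)
            exact one_le_mul_of_one_le_of_one_le h6 h5
        _ = _ := by ring
  · have hr2 : (2 : ℝ) ≤ N / dy := by
      rw [le_div_iff₀ hdy0]; exact_mod_cast hN
    have hr0 : (0 : ℝ) < N / dy := by linarith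
    -- The inverse of `q` is the growth function without its logarithmic factor and without `m ^ 2`.
    set q := (A * T / (N / dy)) ^ (1 / ((m : ℝ) + 1)) with hq
    have hq0 : 0 < q := by positivity
    have hqN : A * T * dy = N * q ^ (m + 1) := by
      have h1 : q ^ (m + 1) = A * T / (N / dy) := by
        rw [hq, ← Real.rpow_natCast, ← Real.rpow_mul (by positivity)]
        push_cast
        rw [one_div, inv_mul_cancel₀ (by positivity), Real.rpow_one]
      have hN0 : (N : ℝ) ≠ 0 := by
        rintro h; rw [h, zero_div] at hr0; exact lt_irrefl _ hr0
      rw [h1]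
      field_simp
    obtain ⟨net, h1, h2, h3, h4⟩ := ha.exists_net_of_size hm hdy hT hA hR hD hz' hmN hq0 hqN
    refine ⟨net, h1, h2.mono ?_, h3.mono htime, h4.mono le_rfl hcomp⟩
    rw [← hL]
    have h5 := TransportDNN.rpow_le_inv_growth (dy := dy) hm hAT hr2
    gcongr
    linarith
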